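/- A sequence $A[1],A[2],\dots$ of values from a linearly ordered set is streamed, intermixed with other commands. The commands are: $\mathtt{Value}\ v$ (append $v$ to $A$); $\mathtt{Mark}$ (later queries may start at the current, i.e. last, position $j$); $\mathtt{Query}\ i$ (report $\min\{A[k] : i\le k\le j\}$, where $j$ is the current position); $\mathtt{Close}\ i$ (no later query starts at $i$). A position is active if it has been marked and not closed. A sequence of commands is valid if $\mathtt{Mark}$ is issued only when at least one value has been given and at most once per position, and $\mathtt{Query}\ i$ and $\mathtt{Close}\ i$ are issued only when $i$ is active. Let $\ell$ be the maximum, over all instants, of the number of active positions, and let $n$ be the number of values given. The machine is a randomized word RAM with words of $w$ bits: it has unit-cost arithmetic, comparison and memory access, it can draw a uniformly random word in one step, and it can store, copy and compare values, each value taking one memory cell. **Theorem.** Valid sequences of RMQ commands can be processed in real time, in $O(\ell)$ space and in $O(\log \ell)$ time per operation with high probability. Precisely, there are a program $P$ for this machine and a constant $K$ such that, for every linearly ordered set of values, every valid sequence of commands and every word size $w$ with $2^w\ge K(n+1)$, where neither $n$ nor $\ell$ is given to the program in advance: 1. whatever the random words are, $P$ processes the commands one after the other, each completely before the next one is revealed;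 it halts on each command, answers every query correctly, and never accesses memory outside a region of $K(\ell+1)$ cells in total; 2. for every $c\in\mathbb N$ there is a constant $T$, depending only on $c$, such that each single command is processed in at most $T\log(\ell+2)$ steps with probability at least $1-(\ell+2)^{-c}$ over the random words. -/

import Mathlib

namespace RMQ

/-! ### Sequences of commands -/

/-- The commands, over a linearly ordered type `α` of values:
`value v` appends `v` to the array, `mark` announces that later queries may start at the current
(last) position, `query i` asks for the minimum from position `i` to the current position, and
`close i` announces that no later query starts at `i`. Positions are numbered from `1`. -/
inductive Cmd (α : Type*) where
  | value (v : α)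
  | mark
  | query (i : ℕ)
  | close (i : ℕ)

/-- What a sequence of commands has done so far: the number of values given (that is, the current
position), the positions that were marked, and the positions that were closed. -/
structure Status where
  pos : ℕ
  marked : Finset ℕ
  closed : Finset ℕ

/-- The effect of one command on the status. -/
def Status.next {α : Type*} (t : Status) : Cmd α → Status
  | .value _ => { t with pos := t.pos + 1 }
  | .mark => { t with marked := insert t.pos t.marked }
  | .query _ => t
  | .close i => { t with closed := insert i t.closed }

/-- The status after a sequence of commands. -/
def status {α : Type*} (cs : List (Cmd α)) : Status :=
  cs.foldl Status.next ⟨0, ∅, ∅⟩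

/-- The active positions: marked and not closed. -/
def active {α : Type*} (cs : List (Cmd α)) : Finset ℕ :=
  (status cs).marked \ (status cs).closed

/-- The array given by a sequence of commands (entry number `k` is at list index `k - 1`). -/
def array {α : Type*} (cs : List (Cmd α)) : List α :=
  cs.filterMap fun
    | .value v => some v
    | _ => none

/-- `c` may be issued after the commands `cs`: a position is marked at most once, and only active
positions are queried or closed. -/
def Admissible {α : Type*} (cs : List (Cmd α)) : Cmd α → Prop
  | .value _ => True
  | .mark => 1 ≤ (status cs).pos ∧ (status cs).pos ∉ (status cs).marked
  | .query i => i ∈ active cs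
  | .close i => i ∈ active cs

/-- A non-pathological sequence of commands. -/
def Valid {α : Type*} (cs : List (Cmd α)) : Prop :=
  ∀ (k : ℕ) (c : Cmd α), cs[k]? = some c → Admissible (cs.take k) c

/-- The parameter `ℓ`: the maximum, over all instants, of the number of active positions. -/
def maxActive {α : Type*} (cs : List (Cmd α)) : ℕ :=
  (Finset.range (cs.length + 1)).sup fun k => (active (cs.take k)).card

/-- `x = min {A[k] | i ≤ k ≤ j}`, where `A` is the array given by `cs` and `j` is its last
position. -/
def IsRangeMin {α : Type*} [LinearOrder α] (cs : List (Cmd α)) (i : ℕ) (x : α) : Prop :=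
  IsLeast {a | ∃ k, 1 ≤ k ∧ i ≤ k ∧ k ≤ (array cs).length ∧ (array cs)[k - 1]? = some a} x

/-! ### A randomized word RAM

The machine has words of `w` bits, represented by the natural numbers below `2 ^ w`, and
values from `α`, which it can only copy and compare; a value cell that was never written holds the
sentinel `-∞`, that is `⊥ : WithBot α`. There are registers and a random access memory for words,
and the same for values; both memories are addressed by words. A program mentions finitely many
registers. -/

/-- States of the machine. The fields `used` and `vused` record the number of cells taken by the
word memory and by the value memory: the least number above all addresses accessed so far.
The field `coins` is the number of random words drawn so far. -/
structure State (α : Type*) where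
  reg : ℕ → ℕ
  vreg : ℕ → WithBot α
  mem : ℕ → ℕ
  vmem : ℕ → WithBot α
  used : ℕ
  vused : ℕ
  coins : ℕ

/-- The state in which the machine starts. -/
def State.init (α : Type*) : State α where
  reg := fun _ => 0
  vreg := fun _ => ⊥
  mem := fun _ => 0
  vmem := fun _ => ⊥
  used := 0
  vused := 0
  coins := 0

/-- The memory space taken so far, in cells. -/
def State.space {α : Type*} (s : State α) : ℕ := s.used + s.vused

/-- Arithmetic on words. -/
inductive Arith where
  | add | sub | mul | div | mod

/-- Arithmetic on words of `w` bits, modulo `2 ^ w`. -/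
def Arith.eval (w : ℕ) : Arith → ℕ → ℕ → ℕ
  | .add, a, b => (a + b) % 2 ^ w
  | .sub, a, b => (a + (2 ^ w - b)) % 2 ^ w
  | .mul, a, b => (a * b) % 2 ^ w
  | .div, a, b => (a / b) % 2 ^ w
  | .mod, a, b => (a % b) % 2 ^ w

/-- Elementary instructions. The arguments are numbers of registers, except the second argument
of `const`, which is a constant. -/
inductive Instr where
  /-- do nothing -/
  | skip
  /-- word register `r` := constant `n` -/
  | const (r n : ℕ)
  /-- word register `r` := word register `a` -/
  | copy (r a : ℕ)
  /-- word register `r` := `a` `o` `b` -/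
  | arith (o : Arith) (r a b : ℕ)
  /-- word register `r` := word memory at the address in `a` -/
  | load (r a : ℕ)
  /-- word memory at the address in `a` := word register `r` -/
  | store (a r : ℕ)
  /-- value register `r` := value register `a` -/
  | vcopy (r a : ℕ)
  /-- value register `r` := value memory at the address in word register `a` -/
  | vload (r a : ℕ)
  /-- value memory at the address in word register `a` := value register `r` -/
  | vstore (a r : ℕ)
  /-- word register `r` := fresh uniformly random word -/
  | rand (r : ℕ)

/-- The effect of an elementary instruction; `ω` is the sequence of random words. -/
def Instr.apply {α : Type*} (w : ℕ) (ω : ℕ → Fin (2 ^ w)) (s : State α) : Instr → State α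
  | .skip => s
  | .const r n => { s with reg := Function.update s.reg r (n % 2 ^ w) }
  | .copy r a => { s with reg := Function.update s.reg r (s.reg a) }
  | .arith o r a b => { s with reg := Function.update s.reg r (o.eval w (s.reg a) (s.reg b)) }
  | .load r a => { s with
      reg := Function.update s.reg r (s.mem (s.reg a))
      used := max s.used (s.reg a + 1) }
  | .store a r => { s with
      mem := Function.update s.mem (s.reg a) (s.reg r)
      used := max s.used (s.reg a + 1) }
  | .vcopy r a => { s with vreg := Function.update s.vreg r (s.vreg a) }
  | .vload r a => { s with
      vreg := Function.update s.vreg r (s.vmem (s.reg a))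
      vused := max s.vused (s.reg a + 1) }
  | .vstore a r => { s with
      vmem := Function.update s.vmem (s.reg a) (s.vreg r)
      vused := max s.vused (s.reg a + 1) }
  | .rand r => { s with
      reg := Function.update s.reg r (ω s.coins)
      coins := s.coins + 1 }

/-- Tests: comparisons of word registers (`lt`, `le`, `eq`, `ne`) and of value registers
(`vlt`, `vle`). -/
inductive Test where
  | lt (a b : ℕ)
  | le (a b : ℕ)
  | eq (a b : ℕ)
  | ne (a b : ℕ)
  | vlt (a b : ℕ)
  | vle (a b : ℕ)

/-- The test succeeds in the state `s`. -/
def Test.Holds {α : Type*} [LinearOrder α] (s : State α) : Test → Prop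
  | .lt a b => s.reg a < s.reg b
  | .le a b => s.reg a ≤ s.reg b
  | .eq a b => s.reg a = s.reg b
  | .ne a b => s.reg a ≠ s.reg b
  | .vlt a b => s.vreg a < s.vreg b
  | .vle a b => s.vreg a ≤ s.vreg b

/-- Code for the machine. -/
inductive Code where
  | instr (i : Instr)
  | seq (c d : Code)
  | ite (b : Test) (c d : Code)
  | while (b : Test) (c : Code)

/-- `Exec w ω c s t s'`: the code `c`, started in the state `s`, halts after `t` steps in the
state `s'`. Every elementary instruction and every evaluation of a test takes one step. -/
inductive Exec {α : Type*} [LinearOrder α] (w : ℕ) (ω : ℕ → Fin (2 ^ w)) :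
    Code → State α → ℕ → State α → Prop where
  | instr (i : Instr) (s : State α) : Exec w ω (.instr i) s 1 (i.apply w ω s)
  | seq {c d : Code} {s s' s'' : State α} {t t' : ℕ} :
      Exec w ω c s t s' → Exec w ω d s' t' s'' → Exec w ω (.seq c d) s (t + t') s''
  | ite_true {b : Test} {c d : Code} {s s' : State α} {t : ℕ} :
      b.Holds s → Exec w ω c s t s' → Exec w ω (.ite b c d) s (t + 1) s'
  | ite_false {b : Test} {c d : Code} {s s' : State α} {t : ℕ} :
      ¬ b.Holds s → Exec w ω d s t s' → Exec w ω (.ite b c d) s (t + 1) s'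
  | while_true {b : Test} {c : Code} {s s' s'' : State α} {t t' : ℕ} :
      b.Holds s → Exec w ω c s t s' → Exec w ω (.while b c) s' t' s'' →
        Exec w ω (.while b c) s (t + t' + 1) s''
  | while_false {b : Test} {c : Code} {s : State α} :
      ¬ b.Holds s → Exec w ω (.while b c) s 1 s

/-! ### Processing a sequence of commands -/

/-- A program: the code to be executed for each kind of command. -/
structure Program where
  onValue : Code
  onMark : Code
  onQuery : Code
  onClose : Code

/-- The code to be executed for a command. -/
def Program.code {α : Type*} (P : Program) : Cmd α → Code
  | .value _ => P.onValue
  | .mark => P.onMark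
  | .query _ => P.onQuery
  | .close _ => P.onClose

/-- The argument of a command is handed to the program in the value register `0` (for `value`) or
in the word register `0` (for `query` and `close`). -/
def State.input {α : Type*} (w : ℕ) (s : State α) : Cmd α → State α
  | .value v => { s with vreg := Function.update s.vreg 0 (v : WithBot α) }
  | .mark => s
  | .query i => { s with reg := Function.update s.reg 0 (i % 2 ^ w) }
  | .close i => { s with reg := Function.update s.reg 0 (i % 2 ^ w) }

/-- `Run P w ω s cs tr s'`: started in the state `s`, the program processes the commands `cs` one
after the other (each to the end before the next one is revealed) and arrives in the state `s'`.
The list `tr` has one entry for each command: the number of steps spent on it, and the content of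
the value register `0` when it was done, which is the answer if the command is a query. -/
inductive Run {α : Type*} [LinearOrder α] (P : Program) (w : ℕ) (ω : ℕ → Fin (2 ^ w)) :
    State α → List (Cmd α) → List (ℕ × WithBot α) → State α → Prop where
  | nil (s : State α) : Run P w ω s [] [] s
  | cons {s s' s'' : State α} {c : Cmd α} {cs : List (Cmd α)} {t : ℕ}
      {tr : List (ℕ × WithBot α)} :
      Exec w ω (P.code c) (s.input w c) t s' → Run P w ω s' cs tr s'' →
        Run P w ω s (c :: cs) ((t, s'.vreg 0) :: tr) s''

/-- The law of the sequence of random words: independent and uniformly distributed. -/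
noncomputable def wordLaw (w : ℕ) : MeasureTheory.Measure (ℕ → Fin (2 ^ w)) :=
  MeasureTheory.Measure.infinitePi fun _ => (PMF.uniformOfFintype (Fin (2 ^ w))).toMeasure

/-- On the random words `ω`, the program spends at most `b` steps on command number `k` (counted
from `0`) of the sequence `cs`. -/
def StepsAtMost {α : Type*} [LinearOrder α] (P : Program) (w : ℕ) (cs : List (Cmd α)) (k : ℕ)
    (b : ℝ) (ω : ℕ → Fin (2 ^ w)) : Prop :=
  ∃ (tr : List (ℕ × WithBot α)) (s : State α) (t : ℕ) (x : WithBot α),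
    Run P w ω (State.init α) cs tr s ∧ tr[k]? = some (t, x) ∧ (t : ℝ) ≤ b

end RMQ

namespace RMQ

/-! ### The data structure -/

/-! The algorithm is deterministic: it draws no random word, so the time bound holds surely and the
exceptional event is empty.

The minimum up to the current position does not decrease when the left end moves right. So the
marked positions fall into intervals, the groups, each with one minimum for its active positions,
and these minima are sorted along with the starts. A new value `v` affects exactly the groups whose
minimum is at least `v`. They form a suffix and are merged into the first of them by a change of the
array bounds. A query is a binary search for the last group that starts no later than `i`; a closure
is a binary search for the entry of `i`, whose flag is cleared.

Closed positions are reclaimed in passes that are spread over the marks. A pass takes the entries in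
order, drops the dead ones and packs the living ones at the front; new entries are appended at the
end meanwhile. Both arrays thus consist of a kept part, a gap and a pending part, and the binary
search jumps over the gap. A moved entry takes its group along unless that group is already kept;
the pending groups before it contain no active position (`Inv.moveEntry`).

Every mark adds one entry and performs three steps of the pass. If a pass begins with at most `2 * ℓ
+ 3` entries, it ends with `len ≤ 3 * ℓ + 6`. The kept entries were alive at the start of the pass,
at most `ℓ` of them, or were marked during it, which happens about `len / 3` times. So at most `2 *
ℓ + 3` are left and the bound reproduces itself (`Inv.restart`). The program never uses `ℓ`: it
occurs only in the invariant.

The invariant is carried to the machine by weakest preconditions that count steps; `wp_search` gives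
the logarithm, and `run_program` adds up the commands. -/

/-- The data kept by the program. There are two arrays with a gap. The *entries* occupy the slots
below `kept` and those from `next` to `len`; an entry consists of a marked position `key` and of a
flag `alive`, which is cleared when the position is closed. The *groups* occupy the slots below
`gkept` and those from `gnext` to `glen`; a group consists of its first position `start` and of the
value `val`, which is the range minimum for all active positions of the group. -/
structure Data (α : Type*) where
  len : ℕ
  kept : ℕ
  next : ℕ
  glen : ℕ
  gkept : ℕ
  gnext : ℕ
  pos : ℕ
  key : ℕ → ℕ
  alive : ℕ → ℕ
  start : ℕ → ℕ
  val : ℕ → WithBot α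
  last : WithBot α

/-- The slots of an array of length `l` in which those from `p` to `r` are unused. -/
def Live (p r l x : ℕ) : Prop := x < p ∨ r ≤ x ∧ x < l

/-- Among the slots satisfying `L`, those satisfying `P` are exactly the ones below `e`, and `e` is
`0` or follows such a slot. -/
structure IsCut (L P : ℕ → Prop) (e : ℕ) : Prop where
  lt_iff : ∀ x, L x → (x < e ↔ P x)
  pred_mem : e = 0 ∨ L (e - 1)

namespace Data

variable {α : Type*}

/-- The slots occupied by entries. -/
def Entry (D : Data α) (x : ℕ) : Prop := Live D.kept D.next D.len x

/-- The slots occupied by groups. -/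
def Group (D : Data α) (x : ℕ) : Prop := Live D.gkept D.gnext D.glen x

/-- The number of living entries beyond the gap. -/
def pending (D : Data α) : ℕ := ((Finset.Ico D.next D.len).filter fun x => D.alive x ≠ 0).card

/-- The invariant of the data structure: `M` is the set of marked positions, `A` the set of active
ones, and `R i x` says that `x` is the range minimum for the position `i`. -/
structure Inv [LinearOrder α] (D : Data α) (M A : Finset ℕ) (R : ℕ → α → Prop) (ℓ d : ℕ) :
    Prop where
  kept_le : D.kept ≤ D.next
  next_le : D.next ≤ D.len
  gkept_le : D.gkept ≤ D.gnext
  gnext_le : D.gnext ≤ D.glen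
  glen_le : D.glen ≤ D.len
  gkept_le_kept : D.gkept ≤ D.kept
  key_lt : ∀ x y, D.Entry x → D.Entry y → x < y → D.key x < D.key y
  start_lt : ∀ x y, D.Group x → D.Group y → x < y → D.start x < D.start y
  val_le : ∀ x y, D.Group x → D.Group y → x < y → D.val x ≤ D.val y
  key_mem : ∀ x, D.Entry x → D.key x ∈ M
  start_mem : ∀ x, D.Group x → D.start x ∈ M
  alive_mem : ∀ x, D.Entry x → D.alive x ≠ 0 → D.key x ∈ A
  exists_entry : ∀ i ∈ A, ∃ x, D.Entry x ∧ D.key x = i ∧ D.alive x ≠ 0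
  exists_group : ∀ i ∈ A, ∃ g, D.Group g ∧ D.start g ≤ i ∧
    (∀ h, D.Group h → g < h → i < D.start h) ∧ ∃ x : α, D.val g = x ∧ R i x
  -- The group of a kept entry is itself kept; this allows pending groups to be dropped when they
  -- are skipped and when the pass ends.
  key_lt_start : ∀ x < D.kept, ∀ g, D.gnext ≤ g → g < D.glen → D.key x < D.start g
  val_le_last : ∀ x, D.Group x → D.val x ≤ D.last
  -- Here `d` is the number of steps of the pass still owed to the last mark. An append raises `d`
  -- by 3 and a step trades one unit of `d` for one unit of `next`, so `next + d` is three times the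
  -- number of marks in the current pass.
  len_bound : 3 * D.len ≤ 3 * (2 * ℓ + 3) + D.next + d
  count_bound : 3 * (D.kept + D.pending) ≤ 3 * ℓ + D.next + d

/-- Append the value `v`; `e` is the first slot after the groups with smaller values. -/
def value (D : Data α) (v : WithBot α) (e : ℕ) : Data α :=
  if e < D.gkept then
    { D with
      pos := D.pos + 1
      last := v
      val := Function.update D.val e v
      gkept := e + 1
      gnext := D.glen }
  else if max e D.gnext < D.glen then
    { D with
      pos := D.pos + 1
      last := v
      val := Function.update D.val (max e D.gnext) v
      glen := max e D.gnext + 1 }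
  else { D with pos := D.pos + 1, last := v }

/-- Append an entry and a group for the current position. -/
def append (D : Data α) : Data α :=
  { D with
    key := Function.update D.key D.len D.pos
    alive := Function.update D.alive D.len 1
    len := D.len + 1
    start := Function.update D.start D.glen D.pos
    val := Function.update D.val D.glen D.last
    glen := D.glen + 1 }

/-- Clear the flag of the entry `x`. -/
def close (D : Data α) (x : ℕ) : Data α := { D with alive := Function.update D.alive x 0 }

/-- Move the entry `next` to the slot `kept`. -/
def moveEntry (D : Data α) : Data α :=
  { D with
    key := Function.update D.key D.kept (D.key D.next)
    alive := Function.update D.alive D.kept 1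
    kept := D.kept + 1
    next := D.next + 1 }

/-- Drop the entry `next`. -/
def dropEntry (D : Data α) : Data α := { D with next := D.next + 1 }

/-- Move the group `e - 1` to the slot `gkept`, and drop the groups from `gnext` to `e - 1`,
provided that `gnext < e`. -/
def moveGroup (D : Data α) (e : ℕ) : Data α :=
  if D.gnext < e then
    { D with
      start := Function.update D.start D.gkept (D.start (e - 1))
      val := Function.update D.val D.gkept (D.val (e - 1))
      gkept := D.gkept + 1
      gnext := e }
  else D

/-- Begin a new pass. -/
def restart (D : Data α) : Data α :=
  { D with len := D.kept, kept := 0, next := 0, glen := D.gkept, gkept := 0, gnext := 0 }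

/-- Begin a new pass if the current one is over. -/
def finish (D : Data α) : Data α := if D.len ≤ D.next then D.restart else D

/-! ### Preservation of the invariant by the operations on the data -/

namespace Inv

variable [LinearOrder α] {D : Data α} {M A : Finset ℕ} {R R' : ℕ → α → Prop} {ℓ d e : ℕ}

/-- Since `next ≤ len`, the bound on `3 * len` turns into one on `2 * len`. -/
theorem len_le (h : D.Inv M A R ℓ d) (hd : d ≤ 3) : D.len ≤ 3 * ℓ + 6 := by
  have := h.len_bound
  have := h.next_le
  omega

/-- The minima are sorted, so the cut `e` separates those that remain from those that become `v`.
Overwriting one minimum and truncating behind it updates all affected active positions at once. The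
relation `R` enters only through its change to `min x v`. -/
theorem value (h : D.Inv M A R ℓ d) (v : α) (hR : ∀ i ∈ A, ∀ x, R i x → R' i (min x v))
    (he : IsCut D.Group (fun x => D.val x < v) e) : (D.value v e).Inv M A R' ℓ d := by
  obtain ⟨h1, h2, h3, h4, h5, h6, h7, h8, h9, h10, h11, h12, h13, h14, h15, h18, h16, h17⟩ := h
  obtain ⟨he, he'⟩ := he
  unfold Data.value
  split_ifs with c1 c2
  -- The cut lies in the kept part: slot `e` becomes the last group, and the pending part is
  -- emptied.
  · have hG : ∀ x, x < e + 1 → D.Group x := fun x hx => Or.inl (by omega)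
    have hG' : ∀ x, Live (e + 1) D.glen D.glen x → x < e + 1 := by
      intro x hx; unfold Live at hx; omega
    refine ⟨h1, h2, by simp; omega, le_rfl, h5, by simp; omega, h7, ?_, ?_, h10, ?_, h12, h13,
      ?_, ?_, ?_, h16, h17⟩
    · exact fun x y hx hy => h8 x y (hG x (hG' x hx)) (hG y (hG' y hy))
    · intro x y hx hy hxy
      have hx := hG' x hx
      have hy := hG' y hy
      have hxe : x ≠ e := by omega
      by_cases hye : y = e
      · subst hye
        simpa [Function.update_apply, hxe] using ((he x (hG x hx)).1 (by omega)).le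
      · simpa [Function.update_apply, hxe, hye] using h9 x y (hG x hx) (hG y hy) hxy
    · exact fun x hx => h11 x (hG x (hG' x hx))
    · intro i hi
      obtain ⟨g, hg, hgi, hgn, x, hx, hxR⟩ := h14 i hi
      by_cases hge : g < e
      · have hlt := (he g hg).1 hge
        refine ⟨g, Or.inl (by simp; omega), hgi, fun k hk => hgn k (hG k (hG' k hk)), x, ?_, ?_⟩
        · simp [hge.ne, hx]
        · have := hR i hi x hxR
          rw [hx, WithBot.coe_lt_coe] at hlt
          rwa [min_eq_left hlt.le] at this
      · have hlt := mt (he g hg).2 hge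
        refine ⟨e, Or.inl (by simp), ?_, ?_, v, by simp, ?_⟩
        · rcases eq_or_lt_of_le (not_lt.1 hge) with rfl | hlt'
          · exact hgi
          · exact (h8 e g (hG e (by omega)) hg hlt').le.trans hgi
        · intro k hk hek
          have := hG' k hk
          omega
        · have := hR i hi x hxR
          rw [hx, WithBot.coe_lt_coe, not_lt] at hlt
          rwa [min_eq_right hlt] at this
    · intro x _ g hg hg'
      simp at hg hg'
      omega
    · intro x hx
      have hx := hG' x hx
      by_cases hxe : x = e
      · simp [hxe]
      · simpa [Function.update_apply, hxe] using ((he x (hG x hx)).1 (by omega)).le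
  -- A cut that follows the last kept group may point into the gap; `max e gnext` is the first
  -- pending slot at or after it.
  · obtain ⟨b, hb⟩ : ∃ b, b = max e D.gnext := ⟨_, rfl⟩
    rw [← hb] at c2 ⊢
    have hG : ∀ x, Live D.gkept D.gnext (b + 1) x → D.Group x := by
      intro x hx; unfold Live at hx; unfold Data.Group Live; omega
    have hGb : D.Group b := Or.inr (by omega)
    have hbe : ∀ x, D.Group x → (x < b ↔ D.val x < v) := by
      intro x hx
      rw [← he x hx]
      unfold Data.Group Live at hx
      omega
    refine ⟨h1, h2, h3, by simp; omega, by simp; omega, h6, h7, ?_, ?_, h10, ?_, h12, h13,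
      ?_, ?_, ?_, h16, h17⟩
    · exact fun x y hx hy => h8 x y (hG x hx) (hG y hy)
    · intro x y hx hy hxy
      have hyb : y ≤ b := by
        unfold Data.Group Live at hy; simp at hy; omega
      have hxe : x ≠ b := by omega
      by_cases hye : y = b
      · subst hye
        simpa [Function.update_apply, hxe] using ((hbe x (hG x hx)).1 (by omega)).le
      · simpa [Function.update_apply, hxe, hye] using h9 x y (hG x hx) (hG y hy) hxy
    · exact fun x hx => h11 x (hG x hx)
    · intro i hi
      obtain ⟨g, hg, hgi, hgn, x, hx, hxR⟩ := h14 i hi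
      by_cases hge : g < b
      · have hlt := (hbe g hg).1 hge
        refine ⟨g, ?_, hgi, fun k hk => hgn k (hG k hk), x, ?_, ?_⟩
        · unfold Data.Group Live at hg ⊢; simp; omega
        · simp [hge.ne, hx]
        · have := hR i hi x hxR
          rw [hx, WithBot.coe_lt_coe] at hlt
          rwa [min_eq_left hlt.le] at this
      · have hlt := mt (hbe g hg).2 hge
        refine ⟨b, Or.inr (by simp; omega), ?_, ?_, v, by simp, ?_⟩
        · rcases eq_or_lt_of_le (not_lt.1 hge) with rfl | hlt'
          · exact hgi
          · exact (h8 b g hGb hg hlt').le.trans hgi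
        · intro k hk hek
          unfold Data.Group Live at hk
          simp at hk
          omega
        · have := hR i hi x hxR
          rw [hx, WithBot.coe_lt_coe, not_lt] at hlt
          rwa [min_eq_right hlt] at this
    · intro x hx g hg hg'
      simp at hg'
      exact h15 x hx g hg (by omega)
    · intro x hx
      by_cases hxe : x = b
      · simp [hxe]
      · have hxb : x < b := by
          unfold Data.Group Live at hx; simp at hx; omega
        simpa [Function.update_apply, hxe] using ((hbe x (hG x hx)).1 hxb).le
  -- No group lies at or after the cut, so every minimum is below `v` and stays.
  · refine ⟨h1, h2, h3, h4, h5, h6, h7, h8, h9, h10, h11, h12, h13, ?_, h15,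
      fun x (hx : D.Group x) => ((he x hx).1 ?_).le, h16, h17⟩
    swap
    · unfold Data.Group Live at hx; omega
    intro i hi
    obtain ⟨g, hg, hgi, hgn, x, hx, hxR⟩ := h14 i hi
    refine ⟨g, hg, hgi, hgn, x, hx, ?_⟩
    have hlt := (he g hg).1 (by unfold Data.Group Live at hg; omega)
    have := hR i hi x hxR
    rw [hx, WithBot.coe_lt_coe] at hlt
    rwa [min_eq_left hlt.le] at this

/-- The new key exceeds all keys and starts because these are earlier marked positions, and the new
minimum is at least all others by `val_le_last`. One entry costs three units in both bounds, hence
`d + 3`. -/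
theorem append (h : D.Inv M A R ℓ d) (hM : ∀ i ∈ M, i < D.pos) (hA : A ⊆ M) {a : α}
    (ha : D.last = a) (haR : R D.pos a) :
    D.append.Inv (insert D.pos M) (insert D.pos A) R ℓ (d + 3) := by
  obtain ⟨h1, h2, h3, h4, h5, h6, h7, h8, h9, h10, h11, h12, h13, h14, h15, h18, h16, h17⟩ := h
  have hE : ∀ x, D.append.Entry x → D.Entry x ∧ x < D.len ∨ x = D.len := by
    intro x hx; unfold Data.append Data.Entry Live at *; simp at hx; omega
  have hG : ∀ x, D.append.Group x → D.Group x ∧ x < D.glen ∨ x = D.glen := by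
    intro x hx; unfold Data.append Data.Group Live at *; simp at hx; omega
  have hE' : ∀ x, D.Entry x → D.append.Entry x ∧ x ≠ D.len := by
    intro x hx; unfold Data.append Data.Entry Live at *; simp; omega
  have hG' : ∀ x, D.Group x → D.append.Group x ∧ x ≠ D.glen := by
    intro x hx; unfold Data.append Data.Group Live at *; simp; omega
  have hEl : D.append.Entry D.len := Or.inr ⟨h2, by simp [Data.append]⟩
  have hGl : D.append.Group D.glen := Or.inr ⟨h4, by simp [Data.append]⟩
  refine ⟨h1, by simp [Data.append]; omega, h3, by simp [Data.append]; omega,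
    by simp [Data.append]; omega, h6, ?_, ?_, ?_, ?_, ?_, ?_, ?_, ?_, ?_, ?_, ?_, ?_⟩
  · intro x y hx hy hxy
    rcases hE x hx with ⟨hx, hxl⟩ | rfl <;> rcases hE y hy with ⟨hy, hyl⟩ | rfl
    · simpa [Data.append, Function.update_apply, hxl.ne, hyl.ne] using h7 x y hx hy hxy
    · simpa [Data.append, Function.update_apply, hxl.ne] using hM _ (h10 x hx)
    · omega
    · omega
  · intro x y hx hy hxy
    rcases hG x hx with ⟨hx, hxl⟩ | rfl <;> rcases hG y hy with ⟨hy, hyl⟩ | rfl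
    · simpa [Data.append, Function.update_apply, hxl.ne, hyl.ne] using h8 x y hx hy hxy
    · simpa [Data.append, Function.update_apply, hxl.ne] using hM _ (h11 x hx)
    · omega
    · omega
  · intro x y hx hy hxy
    rcases hG x hx with ⟨hx, hxl⟩ | rfl <;> rcases hG y hy with ⟨hy, hyl⟩ | rfl
    · simpa [Data.append, Function.update_apply, hxl.ne, hyl.ne] using h9 x y hx hy hxy
    · simpa [Data.append, Function.update_apply, hxl.ne] using h18 x hx
    · omega
    · omega
  · intro x hx
    rcases hE x hx with ⟨hx, hxl⟩ | rfl
    · simpa [Data.append, Function.update_apply, hxl.ne] using Or.inr (h10 x hx)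
    · simp [Data.append]
  · intro x hx
    rcases hG x hx with ⟨hx, hxl⟩ | rfl
    · simpa [Data.append, Function.update_apply, hxl.ne] using Or.inr (h11 x hx)
    · simp [Data.append]
  · intro x hx
    rcases hE x hx with ⟨hx, hxl⟩ | rfl
    · simpa [Data.append, Function.update_apply, hxl.ne] using fun hh => Or.inr (h12 x hx hh)
    · simp [Data.append]
  · intro i hi
    rcases Finset.mem_insert.1 hi with rfl | hi
    · exact ⟨D.len, hEl, by simp [Data.append]⟩
    · obtain ⟨x, hx, hxi, hxa⟩ := h13 i hi
      refine ⟨x, (hE' x hx).1, ?_⟩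
      simp [Data.append, (hE' x hx).2, hxi, hxa]
  · intro i hi
    rcases Finset.mem_insert.1 hi with rfl | hi
    · refine ⟨D.glen, hGl, by simp [Data.append], ?_, a, by simp [Data.append, ha], haR⟩
      intro k hk hlt
      rcases hG k hk with ⟨_, _⟩ | rfl <;> omega
    · obtain ⟨g, hg, hgi, hgn, x, hx, hxR⟩ := h14 i hi
      have hne := (hG' g hg).2
      refine ⟨g, (hG' g hg).1, ?_, ?_, x, ?_, hxR⟩
      · simpa [Data.append, Function.update_apply, hne] using hgi
      · intro k hk hlt
        rcases hG k hk with ⟨hk, hkl⟩ | rfl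
        · simpa [Data.append, Function.update_apply, hkl.ne] using hgn k hk hlt
        · simpa [Data.append] using hM i (hA hi)
      · simpa [Data.append, Function.update_apply, hne] using hx
  · intro x hx g hg hgl
    have hx : x < D.kept := hx
    have hE : D.Entry x := Or.inl hx
    have hne := (hE' x hE).2
    simp only [Data.append] at hg hgl
    rcases Nat.lt_succ_iff_lt_or_eq.1 hgl with hgl | rfl
    · simpa [Data.append, Function.update_apply, hne, hgl.ne] using h15 x hx g hg hgl
    · simpa [Data.append, Function.update_apply, hne] using hM _ (h10 x hE)
  · intro x hx
    rcases hG x hx with ⟨hx, hxl⟩ | rfl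
    · simpa [Data.append, Function.update_apply, hxl.ne] using h18 x hx
    · simp [Data.append]
  · simp only [Data.append]
    omega
  · have : D.append.pending ≤ D.pending + 1 := by
      unfold Data.pending
      refine (Finset.card_le_card (t := insert D.len _) ?_).trans (Finset.card_insert_le _ _)
      intro x hx
      obtain ⟨hx, hxa⟩ := Finset.mem_filter.1 hx
      have hx : D.next ≤ x ∧ x < D.len + 1 := Finset.mem_Ico.1 hx
      have hxa : Function.update D.alive D.len 1 x ≠ 0 := hxa
      by_cases hxl : x = D.len
      · exact Finset.mem_insert.2 (Or.inl hxl)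
      · rw [Function.update_of_ne hxl] at hxa
        exact Finset.mem_insert_of_mem
          (Finset.mem_filter.2 ⟨Finset.mem_Ico.2 (by omega), hxa⟩)
    simp only [Data.append] at this ⊢
    omega

/-- Keys are distinct, so clearing one flag deactivates `i` alone. Groups are left untouched, and
`pending` can only fall. -/
theorem close (h : D.Inv M A R ℓ d) {i x : ℕ} (hx : D.Entry x) (hi : D.key x = i) :
    (D.close x).Inv M (A \ {i}) R ℓ d := by
  obtain ⟨h1, h2, h3, h4, h5, h6, h7, h8, h9, h10, h11, h12, h13, h14, h15, h18, h16, h17⟩ := h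
  refine ⟨h1, h2, h3, h4, h5, h6, h7, h8, h9, h10, h11, ?_, ?_, ?_, h15, h18, h16, ?_⟩
  · intro y hy hya
    by_cases hxy : y = x
    · simp [Data.close, hxy] at hya
    · simp only [Data.close, Function.update_apply, hxy, if_false] at hya
      refine Finset.mem_sdiff.2 ⟨h12 y hy hya, ?_⟩
      rw [Finset.mem_singleton, ← hi]
      rcases lt_or_gt_of_ne hxy with hlt | hlt
      · exact (h7 y x hy hx hlt).ne
      · exact (h7 x y hx hy hlt).ne'
  · intro k hk
    obtain ⟨hk, hki⟩ := Finset.mem_sdiff.1 hk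
    obtain ⟨y, hy, hyk, hya⟩ := h13 k hk
    have hne : y ≠ x := by
      rintro rfl
      exact hki (by simp [← hyk, hi])
    exact ⟨y, hy, hyk, by simpa [Data.close, Function.update_apply, hne] using hya⟩
  · exact fun k hk => h14 k (Finset.mem_sdiff.1 hk).1
  · have : (D.close x).pending ≤ D.pending := by
      unfold Data.pending
      refine Finset.card_le_card fun y hy => ?_
      simp only [Data.close, Finset.mem_filter, Function.update_apply] at hy ⊢
      refine ⟨hy.1, ?_⟩
      have := hy.2
      split_ifs at this
      · exact absurd rfl this
      · exact this
    exact (Nat.mul_le_mul_left 3 (Nat.add_le_add_left this _)).trans h17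

theorem dropEntry (h : D.Inv M A R ℓ (d + 1)) (hlt : D.next < D.len) (ha : D.alive D.next = 0) :
    D.dropEntry.Inv M A R ℓ d := by
  obtain ⟨h1, h2, h3, h4, h5, h6, h7, h8, h9, h10, h11, h12, h13, h14, h15, h18, h16, h17⟩ := h
  have hE : ∀ x, D.dropEntry.Entry x → D.Entry x := by
    intro x hx; unfold Data.dropEntry Data.Entry Live at *; simp at hx; omega
  refine ⟨by simp [Data.dropEntry]; omega, hlt, h3, h4, h5, h6,
    fun x y hx hy => h7 x y (hE x hx) (hE y hy), h8, h9, fun x hx => h10 x (hE x hx), h11,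
    fun x hx => h12 x (hE x hx), ?_, h14, h15, h18, by simp [Data.dropEntry]; omega, ?_⟩
  · intro i hi
    obtain ⟨x, hx, hxi, hxa⟩ := h13 i hi
    refine ⟨x, ?_, hxi, hxa⟩
    have : x ≠ D.next := by rintro rfl; exact hxa ha
    unfold Data.dropEntry Data.Entry Live at *
    simp
    omega
  · have : D.dropEntry.pending ≤ D.pending := by
      unfold Data.pending
      refine Finset.card_le_card fun y hy => ?_
      obtain ⟨hy, hya⟩ := Finset.mem_filter.1 hy
      have hy : D.next + 1 ≤ y ∧ y < D.len := Finset.mem_Ico.1 hy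
      exact Finset.mem_filter.2 ⟨Finset.mem_Ico.2 (by omega), hya⟩
    simp only [Data.dropEntry] at this ⊢
    omega

/-- The cut `e` makes `e - 1` the group of the entry being moved. If it is pending, it becomes the
next kept group and those before it are dropped; otherwise it is kept already. The sum `kept +
pending` does not grow, since a living entry changes sides. -/
theorem moveEntry (h : D.Inv M A R ℓ (d + 1)) (hlt : D.next < D.len) (ha : D.alive D.next ≠ 0)
    (he : IsCut D.Group (fun x => D.start x ≤ D.key D.next) e) :
    (D.moveGroup e).moveEntry.Inv M A R ℓ d := by
  obtain ⟨D', hD'⟩ : ∃ D', D' = (D.moveGroup e).moveEntry := ⟨_, rfl⟩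
  have e1 : D'.len = D.len := by rw [hD']; unfold Data.moveGroup; split_ifs <;> rfl
  have e2 : D'.kept = D.kept + 1 := by rw [hD']; unfold Data.moveGroup; split_ifs <;> rfl
  have e3 : D'.next = D.next + 1 := by rw [hD']; unfold Data.moveGroup; split_ifs <;> rfl
  have e4 : D'.glen = D.glen := by rw [hD']; unfold Data.moveGroup; split_ifs <;> rfl
  have e5 : D'.key = Function.update D.key D.kept (D.key D.next) := by
    rw [hD']; unfold Data.moveGroup; split_ifs <;> rfl
  have e6 : D'.alive = Function.update D.alive D.kept 1 := by
    rw [hD']; unfold Data.moveGroup; split_ifs <;> rfl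
  have e7 : D.gnext < e ∧ D'.gnext = e ∧ D'.gkept = D.gkept + 1 ∧
      D'.start = Function.update D.start D.gkept (D.start (e - 1)) ∧
      D'.val = Function.update D.val D.gkept (D.val (e - 1)) ∨
      e ≤ D.gnext ∧ D'.gnext = D.gnext ∧ D'.gkept = D.gkept ∧ D'.start = D.start ∧
      D'.val = D.val := by
    rw [hD']; unfold Data.moveGroup; split_ifs with c
    · exact Or.inl ⟨c, rfl, rfl, rfl, rfl⟩
    · exact Or.inr ⟨by omega, rfl, rfl, rfl, rfl⟩
  have e8 : D'.last = D.last := by rw [hD']; unfold Data.moveGroup; split_ifs <;> rfl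
  rw [← hD']
  clear hD'
  obtain ⟨h1, h2, h3, h4, h5, h6, h7, h8, h9, h10, h11, h12, h13, h14, h15, h18, h16, h17⟩ := h
  obtain ⟨he, he'⟩ := he
  have hEn : D.Entry D.next := Or.inr ⟨le_rfl, hlt⟩
  -- entries of the new data and where they come from
  have hE : ∀ x, D'.Entry x → ∃ y, D.Entry y ∧ D'.key x = D.key y ∧
      (D'.alive x ≠ 0 → D.alive y ≠ 0) ∧
      (x < D.kept ∧ y = x ∨ x = D.kept ∧ y = D.next ∨ D.next < x ∧ y = x) := by
    intro x hx
    by_cases hxk : x = D.kept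
    · exact ⟨D.next, hEn, by simp [e5, hxk], fun _ => ha, by omega⟩
    · unfold Data.Entry Live at hx
      rw [e1, e2, e3] at hx
      refine ⟨x, ?_, by simp [e5, hxk],
        by simp [e6, hxk], by omega⟩
      unfold Data.Entry Live
      omega
  have hE' : ∀ y, D.Entry y → ∃ x, D'.Entry x ∧ D'.key x = D.key y ∧
      (D.alive y ≠ 0 → D'.alive x ≠ 0) := by
    intro y hy
    by_cases hyn : y = D.next
    · refine ⟨D.kept, ?_, by simp [e5, hyn], by simp [e6]⟩
      unfold Data.Entry Live; omega
    · have hyk : y ≠ D.kept := by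
        unfold Data.Entry Live at hy; omega
      refine ⟨y, ?_, by simp [e5, hyk],
        by simp [e6, hyk]⟩
      unfold Data.Entry Live at *; omega
  -- Each new group is traced to an old one; the last clause shows that this correspondence
  -- preserves the order.
  have hG : ∀ x, D'.Group x → ∃ y, D.Group y ∧ D'.start x = D.start y ∧ D'.val x = D.val y ∧
      (x < D.gkept ∧ y = x ∨ x = D.gkept ∧ D.gnext < e ∧ y = e - 1 ∨
        e ≤ x ∧ D.gnext ≤ x ∧ y = x) := by
    intro x hx
    unfold Data.Group Live at *
    rcases e7 with ⟨c, c1, c2, c3, c4⟩ | ⟨c, c1, c2, c3, c4⟩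
    · rw [c1, c2, e4] at hx
      by_cases hxk : x = D.gkept
      · exact ⟨e - 1, by omega, by simp [c3, hxk], by simp [c4, hxk], by omega⟩
      · exact ⟨x, by omega, by simp [c3, hxk],
          by simp [c4, hxk], by omega⟩
    · rw [c1, c2, e4] at hx
      exact ⟨x, by omega, by rw [c3], by rw [c4], by omega⟩
  have hpend : D'.pending + 1 ≤ D.pending := by
    unfold Data.pending
    rw [e1, e3, e6]
    have hsub : insert D.next ((Finset.Ico (D.next + 1) D.len).filter fun x =>
        Function.update D.alive D.kept 1 x ≠ 0) ⊆
        (Finset.Ico D.next D.len).filter fun x => D.alive x ≠ 0 := by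
      intro x hx
      simp only [Finset.mem_insert, Finset.mem_filter, Finset.mem_Ico] at hx ⊢
      rcases hx with rfl | ⟨hx, hxa⟩
      · exact ⟨⟨le_rfl, hlt⟩, ha⟩
      · rw [Function.update_of_ne (by omega)] at hxa
        exact ⟨by omega, hxa⟩
    have := Finset.card_le_card hsub
    rwa [Finset.card_insert_of_notMem (by simp)] at this
  refine ⟨by omega, by omega, by omega, ?_, by omega, by omega, ?_, ?_, ?_, ?_, ?_, ?_, ?_, ?_,
    ?_, ?_, by omega, by omega⟩
  · rcases he' with rfl | he'
    · omega
    · unfold Data.Group Live at he'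
      omega
  · intro x y hx hy hxy
    obtain ⟨x', hx', ex, -, cx⟩ := hE x hx
    obtain ⟨y', hy', ey, -, cy⟩ := hE y hy
    rw [ex, ey]
    exact h7 x' y' hx' hy' (by omega)
  · intro x y hx hy hxy
    obtain ⟨x', hx', ex, -, cx⟩ := hG x hx
    obtain ⟨y', hy', ey, -, cy⟩ := hG y hy
    rw [ex, ey]
    exact h8 x' y' hx' hy' (by omega)
  · intro x y hx hy hxy
    obtain ⟨x', hx', -, ex, cx⟩ := hG x hx
    obtain ⟨y', hy', -, ey, cy⟩ := hG y hy
    rw [ex, ey]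
    exact h9 x' y' hx' hy' (by omega)
  · intro x hx
    obtain ⟨x', hx', ex, -, -⟩ := hE x hx
    exact ex ▸ h10 x' hx'
  · intro x hx
    obtain ⟨x', hx', ex, -, -⟩ := hG x hx
    exact ex ▸ h11 x' hx'
  · intro x hx hxa
    obtain ⟨x', hx', ex, ax, -⟩ := hE x hx
    exact ex ▸ h12 x' hx' (ax hxa)
  · intro i hi
    obtain ⟨y, hy, hyi, hya⟩ := h13 i hi
    obtain ⟨x, hx, ex, ax⟩ := hE' y hy
    exact ⟨x, hx, ex.trans hyi, ax hya⟩
  · intro i hi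
    obtain ⟨g, hg, hgi, hgn, x, hx, hxR⟩ := h14 i hi
    -- the groups that are dropped contain no active position
    have hge : D.gnext ≤ g → D.gnext < e → e - 1 ≤ g := by
      intro c1 c2
      by_contra hlt'
      have hGe : D.Group (e - 1) := he'.resolve_left (by omega)
      have h3' := hgn _ hGe (by omega)
      have h4' := (he _ hGe).1 (by omega)
      obtain ⟨y, hy, hyi, -⟩ := h13 i hi
      have hgl : g < D.glen := by unfold Data.Group Live at hg; omega
      rcases hy with hy | hy
      · have := h15 y hy g c1 hgl
        omega
      · rcases eq_or_lt_of_le hy.1 with hy' | hy'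
        · rw [← hy'] at hyi; omega
        · have := h7 _ y hEn (Or.inr hy) hy'
          omega
    obtain ⟨g', hg', es, ev, hc⟩ : ∃ g', D'.Group g' ∧ D'.start g' = D.start g ∧
        D'.val g' = D.val g ∧ (g < D.gkept ∧ g' = g ∨ g' = D.gkept ∧ D.gnext < e ∧ g = e - 1 ∨
        e ≤ g ∧ D.gnext ≤ g ∧ g' = g) := by
      unfold Data.Group Live at *
      rcases e7 with ⟨c, c1, c2, c3, c4⟩ | ⟨c, c1, c2, c3, c4⟩
      · rw [c1, c2, e4]
        by_cases hgg : D.gnext < e ∧ g = e - 1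
        · exact ⟨D.gkept, by omega, by simp [c3, hgg], by simp [c4, hgg], by omega⟩
        · have : g ≠ D.gkept := by omega
          exact ⟨g, by omega, by simp [c3, this],
            by simp [c4, this], by omega⟩
      · rw [c1, c2, e4]
        exact ⟨g, by omega, by rw [c3], by rw [c4], by omega⟩
    refine ⟨g', hg', es ▸ hgi, ?_, x, ev.trans hx, hxR⟩
    intro k hk hlt'
    obtain ⟨k', hk', ek, -, ck⟩ := hG k hk
    rw [ek]
    exact hgn k' hk' (by omega)
  · intro x hx g hg hgl
    have hgG : D'.Group g := Or.inr ⟨hg, hgl⟩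
    obtain ⟨g', hg', eg, -, cg⟩ := hG g hgG
    obtain ⟨x', hx', ex, -, cx⟩ := hE x (Or.inl hx)
    rw [eg, ex]
    -- Groups still pending lie at or after the cut, hence start after the key just moved.
    have h1' : D.key D.next < D.start g' := by
      have := (he g' hg').2
      by_contra hcon
      have := this (by omega)
      omega
    rcases cx with cx | cx | cx
    · rw [cx.2]
      exact h15 x cx.1 g' (by omega) (by omega)
    · rwa [cx.2]
    · omega
  · intro x hx
    obtain ⟨x', hx', -, ex, -⟩ := hG x hx
    rw [ex, e8]
    exact h18 x' hx'

/-- Living entries have distinct active keys. The kept entries become the pending ones of the next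
pass, so this bounds the initial `pending`. -/
theorem card_alive (h : D.Inv M A R ℓ d) (_ : D.next = D.len) :
    ((Finset.range D.kept).filter fun x => D.alive x ≠ 0).card ≤ A.card := by
  refine Finset.card_le_card_of_injOn D.key ?_ ?_
  · intro x hx
    simp only [Finset.coe_filter, Finset.mem_range, Set.mem_ofPred_eq] at hx
    exact h.alive_mem x (Or.inl hx.1) hx.2
  · intro x hx y hy hxy
    simp only [Finset.coe_filter, Finset.mem_range, Set.mem_ofPred_eq] at hx hy
    rcases lt_trichotomy x y with hlt | heq | hlt
    · exact absurd hxy (h.key_lt x y (Or.inl hx.1) (Or.inl hy.1) hlt).ne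
    · exact heq
    · exact absurd hxy (h.key_lt y x (Or.inl hy.1) (Or.inl hx.1) hlt).ne'

theorem mono (h : D.Inv M A R ℓ d) {d' : ℕ} (hd : d ≤ d') : D.Inv M A R ℓ d' :=
  { h with
    len_bound := h.len_bound.trans (by omega)
    count_bound := h.count_bound.trans (by omega) }

/-- At the end of a pass every entry is kept, so by `key_lt_start` the pending groups serve no
active position and may be forgotten. -/
theorem restart (h : D.Inv M A R ℓ d) (hd : d ≤ 3) (hA : A.card ≤ ℓ) (c : D.len ≤ D.next) :
    D.restart.Inv M A R ℓ 0 := by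
  have hnl : D.next = D.len := le_antisymm h.next_le c
  have hcard := (h.card_alive hnl).trans hA
  obtain ⟨h1, h2, h3, h4, h5, h6, h7, h8, h9, h10, h11, h12, h13, h14, h15, h18, h16, h17⟩ := h
  have hE : ∀ x, D.restart.Entry x ↔ x < D.kept := by
    intro x; simp [Data.restart, Data.Entry, Live]
  have hG : ∀ x, D.restart.Group x ↔ x < D.gkept := by
    intro x; simp [Data.restart, Data.Group, Live]
  have hE' : ∀ x, D.Entry x ↔ x < D.kept := by
    intro x; unfold Data.Entry Live; omega
  have hG' : ∀ x, D.restart.Group x → D.Group x := fun x hx => Or.inl ((hG x).1 hx)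
  have hEE : ∀ x, D.restart.Entry x ↔ D.Entry x := fun x => by rw [hE, hE']
  refine ⟨le_rfl, Nat.zero_le _, le_rfl, Nat.zero_le _, h6, le_rfl,
    fun x y hx hy => h7 x y ((hEE x).1 hx) ((hEE y).1 hy),
    fun x y hx hy => h8 x y (hG' x hx) (hG' y hy), fun x y hx hy => h9 x y (hG' x hx) (hG' y hy),
    fun x hx => h10 x ((hEE x).1 hx), fun x hx => h11 x (hG' x hx),
    fun x hx => h12 x ((hEE x).1 hx), ?_, ?_, ?_, fun x hx => h18 x (hG' x hx), ?_, ?_⟩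
  · intro i hi
    obtain ⟨x, hx, hh⟩ := h13 i hi
    exact ⟨x, (hEE x).2 hx, hh⟩
  · intro i hi
    obtain ⟨g, hg, hgi, hgn, hh⟩ := h14 i hi
    refine ⟨g, ?_, hgi, fun k hk => hgn k (hG' k hk), hh⟩
    rw [hG]
    by_contra hgk
    obtain ⟨x, hx, hxi, -⟩ := h13 i hi
    unfold Data.Group Live at hg
    have := h15 x ((hE' x).1 hx) g (by omega) (by omega)
    omega
  · intro x hx
    exact absurd hx (Nat.not_lt_zero x)
  -- With nothing pending, `3 * kept ≤ 3 * ℓ + len + d` and `2 * len ≤ 6 * ℓ + 9 + d`; for `d ≤ 3`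
  -- this gives `kept ≤ 2 * ℓ + 3`, the bound needed for the new length.
  · simp only [Data.restart]
    omega
  · have : D.restart.pending ≤ ℓ := by
      unfold Data.pending
      simpa [Data.restart] using hcard
    simp only [Data.restart] at this ⊢
    omega

end Inv

end Data

/-! ### Weakest preconditions -/

section SetReg

variable {α : Type*} {s : State α}

/-- The state `s` with the number `v` in the word register `k`. -/
def State.setReg (s : State α) (k v : ℕ) : State α :=
  { s with reg := Function.update s.reg k v }

/-- The state `s` with the value `v` in the value register `k`. -/
def State.setVreg (s : State α) (k : ℕ) (v : WithBot α) : State α :=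
  { s with vreg := Function.update s.vreg k v }

@[simp] theorem State.setReg_reg {k v q : ℕ} :
    (s.setReg k v).reg q = if q = k then v else s.reg q := by
  simp [State.setReg, Function.update_apply]

@[simp] theorem State.setReg_vreg {k v : ℕ} : (s.setReg k v).vreg = s.vreg := rfl
@[simp] theorem State.setReg_mem {k v : ℕ} : (s.setReg k v).mem = s.mem := rfl
@[simp] theorem State.setReg_vmem {k v : ℕ} : (s.setReg k v).vmem = s.vmem := rfl
@[simp] theorem State.setReg_used {k v : ℕ} : (s.setReg k v).used = s.used := rfl
@[simp] theorem State.setReg_vused {k v : ℕ} : (s.setReg k v).vused = s.vused := rfl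

@[simp] theorem State.setVreg_vreg {k q : ℕ} {v : WithBot α} :
    (s.setVreg k v).vreg q = if q = k then v else s.vreg q := by
  simp [State.setVreg, Function.update_apply]

@[simp] theorem State.setVreg_reg {k : ℕ} {v : WithBot α} : (s.setVreg k v).reg = s.reg := rfl

end SetReg

section WP

variable {α : Type*} [LinearOrder α] {w : ℕ} {ω : ℕ → Fin (2 ^ w)} {s : State α}
  {Q Q' : ℕ → State α → Prop}

/-- Started in the state `s`, the code `c` halts in a state that together with the number of steps
satisfies `Q`. -/
def WP (w : ℕ) (ω : ℕ → Fin (2 ^ w)) (c : Code) (s : State α) (Q : ℕ → State α → Prop) : Prop :=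
  ∃ t s', Exec w ω c s t s' ∧ Q t s'

theorem WP.mono {c : Code} (h : WP w ω c s Q) (hQ : ∀ t s', Q t s' → Q' t s') :
    WP w ω c s Q' := by
  obtain ⟨t, s', h, hq⟩ := h
  exact ⟨t, s', h, hQ t s' hq⟩

theorem wp_instr {i : Instr} (h : Q 1 (i.apply w ω s)) : WP w ω (.instr i) s Q :=
  ⟨_, _, .instr i s, h⟩

theorem wp_seq {c d : Code}
    (h : WP w ω c s fun t s' => WP w ω d s' fun t' s'' => Q (t + t') s'') :
    WP w ω (.seq c d) s Q := by
  obtain ⟨t, s', h, t', s'', h', hq⟩ := h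
  exact ⟨_, _, .seq h h', hq⟩

theorem wp_ite {b : Test} {c d : Code}
    (hc : b.Holds s → WP w ω c s fun t s' => Q (t + 1) s')
    (hd : ¬ b.Holds s → WP w ω d s fun t s' => Q (t + 1) s') : WP w ω (.ite b c d) s Q := by
  by_cases hb : b.Holds s
  · obtain ⟨t, s', h, hq⟩ := hc hb
    exact ⟨_, _, .ite_true hb h, hq⟩
  · obtain ⟨t, s', h, hq⟩ := hd hb
    exact ⟨_, _, .ite_false hb h, hq⟩

theorem wp_while {b : Test} {c : Code}
    (hc : b.Holds s → WP w ω c s fun t s' =>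
      WP w ω (.while b c) s' fun t' s'' => Q (t + t' + 1) s'')
    (hd : ¬ b.Holds s → Q 1 s) : WP w ω (.while b c) s Q := by
  by_cases hb : b.Holds s
  · obtain ⟨t, s', h, t', s'', h', hq⟩ := hc hb
    exact ⟨_, _, .while_true hb h h', hq⟩
  · exact ⟨_, _, .while_false hb, hd hb⟩

theorem wp_skip (h : Q 1 s) : WP w ω (.instr .skip) s Q := wp_instr h

theorem wp_copy {r a v : ℕ} (ha : s.reg a = v) (h : Q 1 (s.setReg r v)) :
    WP w ω (.instr (.copy r a)) s Q := by
  subst ha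
  exact wp_instr h

theorem wp_vcopy {r a : ℕ} {v : WithBot α} (ha : s.vreg a = v) (h : Q 1 (s.setVreg r v)) :
    WP w ω (.instr (.vcopy r a)) s Q := by
  subst ha
  exact wp_instr h

theorem wp_const {r n : ℕ} (hn : n < 2 ^ w) (h : Q 1 (s.setReg r n)) :
    WP w ω (.instr (.const r n)) s Q := by
  refine wp_instr ?_
  simpa [Instr.apply, State.setReg, Nat.mod_eq_of_lt hn] using h

theorem wp_add {r a b x y : ℕ} (ha : s.reg a = x) (hb : s.reg b = y) (hxy : x + y < 2 ^ w)
    (h : Q 1 (s.setReg r (x + y))) : WP w ω (.instr (.arith .add r a b)) s Q := by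
  refine wp_instr ?_
  simpa [Instr.apply, Arith.eval, State.setReg, ha, hb, Nat.mod_eq_of_lt hxy] using h

theorem wp_sub {r a b x y : ℕ} (ha : s.reg a = x) (hb : s.reg b = y) (hyx : y ≤ x)
    (hx : x < 2 ^ w) (h : Q 1 (s.setReg r (x - y))) :
    WP w ω (.instr (.arith .sub r a b)) s Q := by
  refine wp_instr ?_
  have : (x + (2 ^ w - y)) % 2 ^ w = x - y := by
    rw [show x + (2 ^ w - y) = x - y + 2 ^ w by omega, Nat.add_mod_right,
      Nat.mod_eq_of_lt (by omega)]
  simpa [Instr.apply, Arith.eval, State.setReg, ha, hb, this] using h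

theorem wp_div {r a b x y : ℕ} (ha : s.reg a = x) (hb : s.reg b = y)
    (hx : x < 2 ^ w) (h : Q 1 (s.setReg r (x / y))) :
    WP w ω (.instr (.arith .div r a b)) s Q := by
  refine wp_instr ?_
  have : (x / y) % 2 ^ w = x / y := Nat.mod_eq_of_lt ((Nat.div_le_self x y).trans_lt hx)
  simpa [Instr.apply, Arith.eval, State.setReg, ha, hb, this] using h

end WP

/-! ### The program -/

/-- Sequential composition. -/
local infixr:60 " ;; " => Code.seq

/-- Register `r` becomes one more than register `a`. -/
def succCode (r a : ℕ) : Code := .instr (.const 12 1) ;; .instr (.arith .add r a 12)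

/-- Register `r` becomes one less than register `a`. -/
def predCode (r a : ℕ) : Code := .instr (.const 12 1) ;; .instr (.arith .sub r a 12)

/-- Register `15` becomes the address of the word `k` of the record whose number is in `x`;
a record consists of three words. -/
def addrCode (k x : ℕ) : Code :=
  .instr (.arith .add 15 x x) ;; .instr (.arith .add 15 15 x) ;; .instr (.const 12 k) ;;
    .instr (.arith .add 15 15 12)

/-- Register `r` becomes the word `k` of the record whose number is in `x`. -/
def loadCode (k x r : ℕ) : Code := addrCode k x ;; .instr (.load r 15)

/-- The word `k` of the record whose number is in `x` becomes register `r`. -/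
def storeCode (k x r : ℕ) : Code := addrCode k x ;; .instr (.store 15 r)

/-- Binary search in the array whose dimensions are in the registers `p`, `r` and `l`, for the
first slot at which the test fails. The slot that follows the last success is put into the
register `16`. -/
def searchCode (p r l : ℕ) (probe : Code) (test : Test) : Code :=
  .instr (.const 16 0) ;; .instr (.const 8 0) ;; .instr (.arith .sub 9 l r) ;;
    .instr (.arith .add 9 9 p) ;;
    .while (.lt 8 9) (
      .instr (.arith .add 10 8 9) ;; .instr (.const 12 2) ;; .instr (.arith .div 10 10 12) ;;
      .instr (.copy 11 10) ;;
      .ite (.le p 10) (.instr (.arith .add 11 11 r) ;; .instr (.arith .sub 11 11 p))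
        (.instr .skip) ;;
      probe ;;
      .ite test (succCode 8 10 ;; succCode 16 11) (.instr (.copy 9 10)))

/-- Search for the last entry whose key is at most register `14`. -/
def searchEntryCode : Code := searchCode 2 3 1 (loadCode 0 11 13) (.le 13 14)

/-- Search for the last group that starts at most at register `14`. -/
def searchGroupCode : Code := searchCode 5 6 4 (loadCode 2 11 13) (.le 13 14)

/-- Search for the last group whose value is less than the last value. -/
def searchValCode : Code := searchCode 5 6 4 (.instr (.vload 2 11)) (.vlt 2 1)

/-- The code for `value`. -/
def valueCode : Code :=
  .instr (.vcopy 1 0) ;; succCode 7 7 ;; searchValCode ;;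
    .ite (.lt 16 5)
      (.instr (.vstore 16 1) ;; succCode 5 16 ;; .instr (.copy 6 4))
      (.ite (.lt 16 6) (.instr (.copy 16 6)) (.instr .skip) ;;
        .ite (.lt 16 4) (.instr (.vstore 16 1) ;; succCode 4 16) (.instr .skip))

/-- The code for `Data.append`. -/
def appendCode : Code :=
  storeCode 0 1 7 ;; .instr (.const 13 1) ;; storeCode 1 1 13 ;; succCode 1 1 ;;
    storeCode 2 4 7 ;; .instr (.vstore 4 1) ;; succCode 4 4

/-- The code for `Data.moveGroup`. -/
def moveGroupCode : Code :=
  .ite (.lt 6 16)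
    (predCode 11 16 ;; loadCode 2 11 13 ;; storeCode 2 5 13 ;; .instr (.vload 2 11) ;;
      .instr (.vstore 5 2) ;; succCode 5 5 ;; .instr (.copy 6 16))
    (.instr .skip)

/-- The code for `Data.moveEntry`, where the key is in the register `14`. -/
def moveEntryCode : Code :=
  storeCode 0 2 14 ;; .instr (.const 13 1) ;; storeCode 1 2 13 ;; succCode 2 2 ;; succCode 3 3

/-- The code that moves or drops the entry `next`. -/
def advanceCode : Code :=
  loadCode 1 3 13 ;; .instr (.const 12 0) ;;
    .ite (.ne 13 12)
      (loadCode 0 3 14 ;; searchGroupCode ;; moveGroupCode ;; moveEntryCode)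
      (succCode 3 3)

/-- The code for `Data.finish`. -/
def finishCode : Code :=
  .ite (.le 1 3)
    (.instr (.copy 1 2) ;; .instr (.copy 4 5) ;; .instr (.const 2 0) ;; .instr (.const 3 0) ;;
      .instr (.const 5 0) ;; .instr (.const 6 0))
    (.instr .skip)

/-- One step of the pass through the entries. -/
def sweepCode : Code := .ite (.lt 3 1) advanceCode (.instr .skip) ;; finishCode

/-- The code for `query`. -/
def queryCode : Code :=
  .instr (.copy 14 0) ;; searchGroupCode ;; predCode 11 16 ;; .instr (.vload 0 11)

/-- The code for `close`. -/
def closeCode : Code :=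
  .instr (.copy 14 0) ;; searchEntryCode ;; predCode 11 16 ;; .instr (.const 13 0) ;;
    storeCode 1 11 13

/-- The program for range minimum queries. -/
def program : Program where
  onValue := valueCode
  onMark := appendCode ;; sweepCode ;; sweepCode ;; sweepCode
  onQuery := queryCode
  onClose := closeCode

/-! ### Representation of the data -/

namespace Data

variable {α : Type*}

/-- The word `k` of the record `x`. -/
def word (D : Data α) (k x : ℕ) : ℕ :=
  match k with
  | 0 => D.key x
  | 1 => D.alive x
  | _ => D.start x

/-- Write the word `k` of the record `x`. -/
def setWord (D : Data α) (k x v : ℕ) : Data α :=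
  match k with
  | 0 => { D with key := Function.update D.key x v }
  | 1 => { D with alive := Function.update D.alive x v }
  | _ => { D with start := Function.update D.start x v }

/-- Write the value of the record `x`. -/
def setVal (D : Data α) (x : ℕ) (v : WithBot α) : Data α :=
  { D with val := Function.update D.val x v }

end Data

/-- The state `s` holds the data `D` in the registers from `1` to `7`, in the value register `1` and
in memory, where at most `U` records were accessed. -/
structure Rep {α : Type*} (U : ℕ) (D : Data α) (s : State α) : Prop where
  len : s.reg 1 = D.len
  kept : s.reg 2 = D.kept
  next : s.reg 3 = D.next
  glen : s.reg 4 = D.glen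
  gkept : s.reg 5 = D.gkept
  gnext : s.reg 6 = D.gnext
  pos : s.reg 7 = D.pos
  mem : ∀ x k, k < 3 → s.mem (3 * x + k) = D.word k x
  vmem : s.vmem = D.val
  last : s.vreg 1 = D.last
  used : s.used ≤ 3 * U
  vused : s.vused ≤ U

namespace Rep

variable {α : Type*} {U : ℕ} {D : Data α} {s : State α}

theorem setReg (h : Rep U D s) {k : ℕ} (v : ℕ) (hk : 8 ≤ k) : Rep U D (s.setReg k v) := by
  obtain ⟨h1, h2, h3, h4, h5, h6, h7, h8, h9, h10, h11, h12⟩ := h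
  constructor <;> simp <;> first | assumption | (rw [if_neg (by omega)]; assumption)

theorem setReg_zero (h : Rep U D s) (v : ℕ) : Rep U D (s.setReg 0 v) := by
  obtain ⟨h1, h2, h3, h4, h5, h6, h7, h8, h9, h10, h11, h12⟩ := h
  constructor <;> simpa

theorem setVreg (h : Rep U D s) {k : ℕ} (v : WithBot α) (hk : k ≠ 1) :
    Rep U D (s.setVreg k v) := by
  obtain ⟨h1, h2, h3, h4, h5, h6, h7, h8, h9, h10, h11, h12⟩ := h
  refine ⟨h1, h2, h3, h4, h5, h6, h7, h8, h9, ?_, h11, h12⟩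
  simp only [State.setVreg, Function.update_apply]
  rwa [if_neg hk.symm]

theorem setLast (h : Rep U D s) (v : WithBot α) :
    Rep U { D with last := v } (s.setVreg 1 v) := by
  obtain ⟨h1, h2, h3, h4, h5, h6, h7, h8, h9, h10, h11, h12⟩ := h
  exact ⟨h1, h2, h3, h4, h5, h6, h7, h8, h9, by simp [State.setVreg], h11, h12⟩

theorem setLen (h : Rep U D s) (v : ℕ) : Rep U { D with len := v } (s.setReg 1 v) := by
  obtain ⟨h1, h2, h3, h4, h5, h6, h7, h8, h9, h10, h11, h12⟩ := h
  constructor <;> simp <;> assumption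

theorem setKept (h : Rep U D s) (v : ℕ) : Rep U { D with kept := v } (s.setReg 2 v) := by
  obtain ⟨h1, h2, h3, h4, h5, h6, h7, h8, h9, h10, h11, h12⟩ := h
  constructor <;> simp <;> assumption

theorem setNext (h : Rep U D s) (v : ℕ) : Rep U { D with next := v } (s.setReg 3 v) := by
  obtain ⟨h1, h2, h3, h4, h5, h6, h7, h8, h9, h10, h11, h12⟩ := h
  constructor <;> simp <;> assumption

theorem setGlen (h : Rep U D s) (v : ℕ) : Rep U { D with glen := v } (s.setReg 4 v) := by
  obtain ⟨h1, h2, h3, h4, h5, h6, h7, h8, h9, h10, h11, h12⟩ := h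
  constructor <;> simp <;> assumption

theorem setGkept (h : Rep U D s) (v : ℕ) : Rep U { D with gkept := v } (s.setReg 5 v) := by
  obtain ⟨h1, h2, h3, h4, h5, h6, h7, h8, h9, h10, h11, h12⟩ := h
  constructor <;> simp <;> assumption

theorem setGnext (h : Rep U D s) (v : ℕ) : Rep U { D with gnext := v } (s.setReg 6 v) := by
  obtain ⟨h1, h2, h3, h4, h5, h6, h7, h8, h9, h10, h11, h12⟩ := h
  constructor <;> simp <;> assumption

theorem setPos (h : Rep U D s) (v : ℕ) : Rep U { D with pos := v } (s.setReg 7 v) := by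
  obtain ⟨h1, h2, h3, h4, h5, h6, h7, h8, h9, h10, h11, h12⟩ := h
  constructor <;> simp <;> assumption

end Rep

/-! ### Effect and cost of arithmetic and record access -/

section Blocks

variable {α : Type*} [LinearOrder α] {w : ℕ} {ω : ℕ → Fin (2 ^ w)} {s : State α}
  {Q : ℕ → State α → Prop} {U : ℕ} {D : Data α}

theorem wp_succ {r a v : ℕ} (ha : s.reg a = v) (hv : v + 1 < 2 ^ w) (ha' : a ≠ 12)
    (h : Q 2 ((s.setReg 12 1).setReg r (v + 1))) : WP w ω (succCode r a) s Q :=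
  wp_seq (wp_const (by omega) (wp_add (by simpa [ha'] using ha) (by simp) hv h))

theorem wp_pred {r a v : ℕ} (ha : s.reg a = v) (hv : v < 2 ^ w) (hv' : 1 ≤ v) (ha' : a ≠ 12)
    (h : Q 2 ((s.setReg 12 1).setReg r (v - 1))) : WP w ω (predCode r a) s Q :=
  wp_seq (wp_const (by omega) (wp_sub (by simpa [ha'] using ha) (by simp) hv' hv h))

theorem wp_addr {k x a : ℕ} (hx : s.reg x = a) (hx' : x ≠ 15) (hk : k < 3) (ha : a < U)
    (hU : 3 * U < 2 ^ w)
    (h : Q 4 ((((s.setReg 15 (a + a)).setReg 15 (a + a + a)).setReg 12 k).setReg 15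
      (a + a + a + k))) : WP w ω (addrCode k x) s Q :=
  wp_seq <| wp_add hx hx (by omega) <| wp_seq <|
    wp_add (by simp) (by simpa [hx'] using hx) (by omega) <| wp_seq <|
    wp_const (by omega) <| wp_add (by simp) (by simp) (by omega) h

theorem wp_load {k x r a : ℕ} (hs : Rep U D s) (hx : s.reg x = a) (hx' : x ≠ 15) (hk : k < 3)
    (ha : a < U) (hU : 3 * U < 2 ^ w) (hr : 8 ≤ r)
    (h : ∀ s', Rep U D s' → s'.reg r = D.word k a →
      (∀ q, q ≠ 12 → q ≠ 15 → q ≠ r → s'.reg q = s.reg q) → s'.vreg = s.vreg → Q 5 s') :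
    WP w ω (loadCode k x r) s Q := by
  refine wp_seq (wp_addr hx hx' hk ha hU (wp_instr ?_))
  have hm := hs.mem a k hk
  have e : a + a + a + k = 3 * a + k := by omega
  have hs' := (((((hs.setReg (a + a) (k := 15) (by omega)).setReg (a + a + a) (k := 15)
    (by omega)).setReg k (k := 12) (by omega)).setReg (a + a + a + k) (k := 15)
    (by omega)).setReg (D.word k a) hr)
  refine h _ ⟨?_, ?_, ?_, ?_, ?_, ?_, ?_, hs.mem, hs.vmem, hs.last, ?_, hs.vused⟩ ?_ ?_ rfl
  · simpa [Instr.apply, Function.update_apply, e, hm] using hs'.len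
  · simpa [Instr.apply, Function.update_apply, e, hm] using hs'.kept
  · simpa [Instr.apply, Function.update_apply, e, hm] using hs'.next
  · simpa [Instr.apply, Function.update_apply, e, hm] using hs'.glen
  · simpa [Instr.apply, Function.update_apply, e, hm] using hs'.gkept
  · simpa [Instr.apply, Function.update_apply, e, hm] using hs'.gnext
  · simpa [Instr.apply, Function.update_apply, e, hm] using hs'.pos
  · have := hs.used
    simp [Instr.apply]
    omega
  · simp [Instr.apply, e, hm]
  · intro q h1 h2 h3
    simp [Instr.apply, h1, h2, h3]

theorem wp_store {k x r a v : ℕ} (hs : Rep U D s) (hx : s.reg x = a) (hr : s.reg r = v)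
    (hx' : x ≠ 15) (hr1 : r ≠ 12) (hr2 : r ≠ 15) (hk : k < 3) (ha : a < U) (hU : 3 * U < 2 ^ w)
    (h : ∀ s', Rep U (D.setWord k a v) s' →
      (∀ q, q ≠ 12 → q ≠ 15 → s'.reg q = s.reg q) → s'.vreg = s.vreg → Q 5 s') :
    WP w ω (storeCode k x r) s Q := by
  refine wp_seq (wp_addr hx hx' hk ha hU (wp_instr ?_))
  have e : a + a + a + k = 3 * a + k := by omega
  -- A projection that ignores the three word arrays is unchanged, whichever of them is written.
  have hD : ∀ f : Data α → ℕ,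
      (∀ (D' : Data α) k' a' v', f { D' with key := k', alive := a', start := v' } = f D') →
      f (D.setWord k a v) = f D := by
    intro f hf
    unfold Data.setWord
    split
    · exact hf D _ _ _
    · exact hf D _ _ _
    · exact hf D _ _ _
  refine h _ ⟨?_, ?_, ?_, ?_, ?_, ?_, ?_, ?_, ?_, ?_, ?_, ?_⟩ ?_ rfl
  · rw [hD Data.len (fun _ _ _ _ => rfl)]
    simpa [Instr.apply] using hs.len
  · rw [hD Data.kept (fun _ _ _ _ => rfl)]
    simpa [Instr.apply] using hs.kept
  · rw [hD Data.next (fun _ _ _ _ => rfl)]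
    simpa [Instr.apply] using hs.next
  · rw [hD Data.glen (fun _ _ _ _ => rfl)]
    simpa [Instr.apply] using hs.glen
  · rw [hD Data.gkept (fun _ _ _ _ => rfl)]
    simpa [Instr.apply] using hs.gkept
  · rw [hD Data.gnext (fun _ _ _ _ => rfl)]
    simpa [Instr.apply] using hs.gnext
  · rw [hD Data.pos (fun _ _ _ _ => rfl)]
    simpa [Instr.apply] using hs.pos
  · intro y l hl
    have hm := hs.mem y l hl
    simp only [Instr.apply, State.setReg_reg, State.setReg_mem, if_true, hr1, hr2, if_false, hr,
      e, Function.update_apply, hm]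
    interval_cases k <;> interval_cases l <;>
      simp [Data.setWord, Data.word, Function.update_apply] <;> grind
  · have : (D.setWord k a v).val = D.val := by
      unfold Data.setWord; split <;> rfl
    rw [this]
    exact hs.vmem
  · have : (D.setWord k a v).last = D.last := by
      unfold Data.setWord; split <;> rfl
    rw [this]
    exact hs.last
  · have := hs.used
    simp [Instr.apply]
    omega
  · exact hs.vused
  · intro q h1 h2
    simp [Instr.apply, h1, h2]

theorem wp_vload {x r a : ℕ} (hs : Rep U D s) (hx : s.reg x = a) (ha : a < U) (hr : r ≠ 1)
    (h : ∀ s', Rep U D s' → s'.vreg r = D.val a → s'.reg = s.reg →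
      (∀ q, q ≠ r → s'.vreg q = s.vreg q) → Q 1 s') :
    WP w ω (.instr (.vload r x)) s Q := by
  refine wp_instr (h _ ⟨hs.len, hs.kept, hs.next, hs.glen, hs.gkept, hs.gnext, hs.pos, hs.mem,
    hs.vmem, ?_, hs.used, ?_⟩ ?_ rfl ?_)
  · simpa [Instr.apply, Function.update_apply, hr.symm] using hs.last
  · have := hs.vused
    simp [Instr.apply]
    omega
  · simp [Instr.apply, hs.vmem, hx]
  · intro q hq
    simp [Instr.apply, hq]

theorem wp_vstore {x r a : ℕ} {v : WithBot α} (hs : Rep U D s) (hx : s.reg x = a)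
    (hr : s.vreg r = v) (ha : a < U)
    (h : ∀ s', Rep U (D.setVal a v) s' → s'.reg = s.reg → s'.vreg = s.vreg → Q 1 s') :
    WP w ω (.instr (.vstore x r)) s Q := by
  refine wp_instr (h _ ⟨hs.len, hs.kept, hs.next, hs.glen, hs.gkept, hs.gnext, hs.pos, hs.mem,
    ?_, hs.last, hs.used, ?_⟩ rfl rfl)
  · simp [Instr.apply, Data.setVal, hs.vmem, hx, hr]
  · have := hs.vused
    simp [Instr.apply]
    omega

end Blocks

/-! ### Binary search -/

section Search

variable {α : Type*} {s : State α}

/-- The slot number `x` of an array with unused slots from `p` to `r`. -/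
def slot (p r x : ℕ) : ℕ := if p ≤ x then x + r - p else x

/-- The contents of the registers `8`, `9` and `16` in a binary search. -/
structure SearchInv (P : ℕ → Prop) (p r l : ℕ) (s : State α) : Prop where
  lo_le : s.reg 8 ≤ s.reg 9
  hi_le : s.reg 9 ≤ l - r + p
  lo : ∀ x < s.reg 8, P (slot p r x)
  hi : ∀ x, s.reg 9 ≤ x → x < l - r + p → ¬ P (slot p r x)
  cut : s.reg 16 = if s.reg 8 = 0 then 0 else slot p r (s.reg 8 - 1) + 1

/-- The function `slot` enumerates the live slots in increasing order, so a threshold among their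
ranks is a cut among the slots. -/
theorem SearchInv.isCut {P : ℕ → Prop} {p r l : ℕ} (h : SearchInv P p r l s) (hpr : p ≤ r)
    (hrl : r ≤ l) (he : s.reg 9 ≤ s.reg 8) : IsCut (Live p r l) P (s.reg 16) := by
  obtain ⟨h1, h2, h3, h4, h5⟩ := h
  have e : s.reg 9 = s.reg 8 := by omega
  rw [e] at h4 h2
  generalize s.reg 8 = g at *
  constructor
  · intro x hx
    obtain ⟨y, hy, rfl⟩ : ∃ y, y < l - r + p ∧ slot p r y = x := by
      unfold Live at hx
      rcases hx with hx | hx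
      · exact ⟨x, by omega, by unfold slot; rw [if_neg (by omega)]⟩
      · exact ⟨x - r + p, by omega, by unfold slot; rw [if_pos (by omega)]; omega⟩
    have : slot p r y < s.reg 16 ↔ y < g := by
      rw [h5]
      unfold slot
      split_ifs <;> omega
    rw [this]
    constructor
    · exact h3 y
    · intro hP
      by_contra hc
      exact h4 y (by omega) hy hP
  · rw [h5]
    unfold slot Live
    split_ifs <;> omega

/-- The search bisects ranks of live slots; `P` must hold on an initial segment of them. `I` is what
the caller needs preserved: it must survive writes to the scratch registers except 14, which holds
the key sought. With a probe of at most 6 steps, one round costs at most 20. -/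
theorem wp_search [LinearOrder α] {w : ℕ} {ω : ℕ → Fin (2 ^ w)} {P : ℕ → Prop}
    {I : State α → Prop} {p r l pv rv lv N : ℕ} {probe : Code}
    {test : Test} (hpr : pv ≤ rv) (hrl : rv ≤ lv) (hl : 3 * lv + 3 < 2 ^ w)
    (hp : ∀ s, I s → s.reg p = pv) (hr : ∀ s, I s → s.reg r = rv) (hl' : ∀ s, I s → s.reg l = lv)
    (hI : ∀ s k v, 8 ≤ k → k ≠ 14 → I s → I (s.setReg k v))
    (hprobe : ∀ s, I s → s.reg 11 < lv → WP w ω probe s fun t s' => t ≤ 6 ∧ I s' ∧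
      s'.reg 8 = s.reg 8 ∧ s'.reg 9 = s.reg 9 ∧ s'.reg 10 = s.reg 10 ∧ s'.reg 11 = s.reg 11 ∧
      s'.reg 16 = s.reg 16 ∧ (test.Holds s' ↔ P (s.reg 11)))
    (hP : ∀ x y, Live pv rv lv x → Live pv rv lv y → x < y → P y → P x)
    (hN : lv < 2 ^ N) (hs : I s) :
    WP w ω (searchCode p r l probe test) s fun t s' => t ≤ 20 * N + 5 ∧ I s' ∧
      IsCut (Live pv rv lv) P (s'.reg 16) := by
  have hslot : ∀ x, x < lv - rv + pv → Live pv rv lv (slot pv rv x) := by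
    intro x hx
    unfold slot Live
    split_ifs <;> omega
  have hslot' : ∀ x y, x < y → slot pv rv x < slot pv rv y := by
    intro x y hxy
    unfold slot
    split_ifs <;> omega
  have hslot_lt : ∀ x, x < lv - rv + pv → slot pv rv x < lv := by
    intro x hx
    unfold slot
    split_ifs <;> omega
  -- Induction on an exponent `N` that bounds the length of the interval by `2 ^ N`; a round halves
  -- it.
  have loop : ∀ (N : ℕ) (s : State α), I s → SearchInv P pv rv lv s →
      s.reg 9 - s.reg 8 < 2 ^ N →
      WP w ω (.while (.lt 8 9) (
      .instr (.arith .add 10 8 9) ;; .instr (.const 12 2) ;; .instr (.arith .div 10 10 12) ;;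
      .instr (.copy 11 10) ;;
      .ite (.le p 10) (.instr (.arith .add 11 11 r) ;; .instr (.arith .sub 11 11 p))
        (.instr .skip) ;;
      probe ;;
      .ite test (succCode 8 10 ;; succCode 16 11) (.instr (.copy 9 10)))) s
      fun t s' => t ≤ 20 * N + 1 ∧ I s' ∧ IsCut (Live pv rv lv) P (s'.reg 16) := by
    intro N
    induction N with
    | zero =>
      intro s hs hJ hN
      refine wp_while (fun h => ?_) fun _ => ⟨by omega, hs, hJ.isCut hpr hrl (by omega)⟩
      have : s.reg 8 < s.reg 9 := h
      omega
    | succ N ih =>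
      intro s hs hJ hN
      refine wp_while (fun h => ?_) fun h => ⟨by omega, hs, hJ.isCut hpr hrl (not_lt.1 h)⟩
      have hlt : s.reg 8 < s.reg 9 := h
      have hle := hJ.hi_le
      obtain ⟨mid, hmid⟩ : ∃ mid, mid = (s.reg 8 + s.reg 9) / 2 := ⟨_, rfl⟩
      refine wp_seq (wp_add rfl rfl (by omega) (wp_seq (wp_const (by omega) (wp_seq
        (wp_div (by simp; rfl) (by simp; rfl) (by omega) (wp_seq (wp_copy (by simp; rfl)
        ?_)))))))
      rw [← hmid]
      set s1 : State α := (((s.setReg 10 (s.reg 8 + s.reg 9)).setReg 12 2).setReg 10 mid).setReg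
        11 mid with hs1
      have hIs1 : I s1 := hI _ _ _ (by omega) (by omega) (hI _ _ _ (by omega) (by omega)
        (hI _ _ _ (by omega) (by omega) (hI _ _ _ (by omega) (by omega) hs)))
      -- The rest of the round, once register 11 holds the slot of rank `mid`; shared by ranks
      -- before and after the gap.
      have key : ∀ (s' : State α) (t : ℕ), t ≤ 3 → I s' → s'.reg 8 = s.reg 8 →
          s'.reg 9 = s.reg 9 → s'.reg 10 = mid → s'.reg 11 = slot pv rv mid →
          s'.reg 16 = s.reg 16 →
          WP w ω (probe ;; .ite test (succCode 8 10 ;; succCode 16 11) (.instr (.copy 9 10))) s'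
          fun t' s'' => WP w ω (.while (.lt 8 9) (
            .instr (.arith .add 10 8 9) ;; .instr (.const 12 2) ;;
            .instr (.arith .div 10 10 12) ;; .instr (.copy 11 10) ;;
            .ite (.le p 10) (.instr (.arith .add 11 11 r) ;; .instr (.arith .sub 11 11 p))
              (.instr .skip) ;;
            probe ;;
            .ite test (succCode 8 10 ;; succCode 16 11) (.instr (.copy 9 10)))) s''
          fun t'' s''' => (1 + (1 + (1 + (1 + (t + t')))) + t'' + 1) ≤ 20 * (N + 1) + 1 ∧
            I s''' ∧ IsCut (Live pv rv lv) P (s'''.reg 16) := by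
        intro s' t ht hIs' e8 e9 e10 e11 e16
        refine wp_seq ((hprobe s' hIs' (by rw [e11]; exact hslot_lt _ (by omega))).mono ?_)
        rintro t1 s2 ⟨ht1, hIs2, f8, f9, f10, f11, f16, htest⟩
        rw [e11] at htest
        rw [e8] at f8
        rw [e9] at f9
        rw [e10] at f10
        rw [e11] at f11
        rw [e16] at f16
        have hml := hslot_lt mid (by omega)
        refine wp_ite (fun hb => ?_) fun hb => ?_
        · refine wp_seq (wp_succ f10 (by omega) (by omega) (wp_succ (v := slot pv rv mid)
            (by simpa using f11) (by omega) (by omega) ?_))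
          refine (ih _ (hI _ _ _ (by omega) (by omega) (hI _ _ _ (by omega) (by omega)
            (hI _ _ _ (by omega) (by omega) (hI _ _ _ (by omega) (by omega) hIs2)))) ?_ ?_).mono ?_
          · constructor
            · simp [f9]; omega
            · simpa [f9] using hle
            · intro x hx
              simp at hx
              rcases hx.lt_or_eq with hx | rfl
              · exact hP _ _ (hslot _ (by omega)) (hslot _ (by omega)) (hslot' _ _ hx)
                  (htest.1 hb)
              · exact htest.1 hb
            · intro x hx
              simp [f9] at hx
              exact hJ.hi x hx
            · simp
          · simp [f9]
            rw [pow_succ] at hN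
            omega
          · rintro t2 s3 ⟨h1, h2⟩
            exact ⟨by omega, h2⟩
        · refine wp_copy f10 ?_
          refine (ih _ (hI _ _ _ (by omega) (by omega) hIs2) ?_ ?_).mono ?_
          · constructor
            · simp [f8]; omega
            · simp; omega
            · intro x hx
              simp [f8] at hx
              exact hJ.lo x hx
            · intro x hx hxl
              simp at hx
              rcases eq_or_lt_of_le hx with rfl | hx
              · exact fun hh => hb (htest.2 hh)
              · exact fun hh => hb (htest.2 (hP _ _ (hslot _ (by omega)) (hslot _ (by omega))
                  (hslot' _ _ hx) hh))
            · simpa [f8, f16] using hJ.cut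
          · simp [f8]
            rw [pow_succ] at hN
            omega
          · rintro t2 s3 ⟨h1, h2⟩
            exact ⟨by omega, h2⟩
      have hs1p : s1.reg p = pv := hp _ hIs1
      have hs1r : s1.reg r = rv := hr _ hIs1
      refine wp_seq (wp_ite (fun hb => ?_) fun hb => ?_)
      · have hb : s1.reg p ≤ s1.reg 10 := hb
        have hb' : pv ≤ mid := by
          rw [hs1p] at hb
          simpa [hs1] using hb
        refine wp_seq (wp_add (x := mid) (by simp [hs1]) hs1r (by omega) (wp_sub
          (x := mid + rv) (by simp) (hp _ (hI _ _ _ (by omega) (by omega) hIs1)) (by omega)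
          (by omega) ?_))
        refine key _ _ (by omega) (hI _ _ _ (by omega) (by omega) (hI _ _ _ (by omega)
          (by omega) hIs1)) ?_ ?_ ?_ ?_ ?_
        all_goals simp [hs1, slot, hb']
      · have hb : ¬ s1.reg p ≤ s1.reg 10 := hb
        have hb' : ¬ pv ≤ mid := by
          rw [hs1p] at hb
          simpa [hs1] using hb
        refine wp_skip ?_
        refine key _ _ (by omega) hIs1 ?_ ?_ ?_ ?_ ?_
        all_goals simp [hs1, slot]
        omega
  have hI1 : I ((s.setReg 16 0).setReg 8 0) := hI _ _ _ (by omega) (by omega) (hI _ _ _ (by omega)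
    (by omega) hs)
  refine wp_seq (wp_const (by omega) (wp_seq (wp_const (by omega) (wp_seq (wp_sub (hl' _ hI1)
    (hr _ hI1) hrl (by omega) (wp_seq (wp_add (x := lv - rv) (by simp) (hp _ (hI _ _ _ (by omega)
    (by omega) hI1)) (by omega) ?_)))))))
  refine (loop N _ (hI _ _ _ (by omega) (by omega) (hI _ _ _ (by omega) (by omega) hI1))
    ?_ ?_).mono ?_
  · constructor <;> simp
    intro x hx hxl
    omega
  · simp
    omega
  · rintro t s' ⟨h1, h2⟩
    exact ⟨by omega, h2⟩

end Search

/-! ### Correctness of the code for the commands -/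

section Commands

variable {α : Type*} [LinearOrder α] {w : ℕ} {ω : ℕ → Fin (2 ^ w)} {s : State α}
  {U N : ℕ} {D : Data α} {M A : Finset ℕ} {R : ℕ → α → Prop} {ℓ d : ℕ}

theorem wp_searchEntry (hs : Rep U D s) (hD : D.Inv M A R ℓ d) (hl : D.len < U)
    (hU : 3 * U + 3 < 2 ^ w) (hN : U < 2 ^ N) :
    WP w ω searchEntryCode s fun t s' => t ≤ 20 * N + 5 ∧ Rep U D s' ∧
      IsCut D.Entry (fun x => D.key x ≤ s.reg 14) (s'.reg 16) := by
  refine (wp_search (P := fun x => D.key x ≤ s.reg 14)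
    (I := fun s' => Rep U D s' ∧ s'.reg 14 = s.reg 14) (N := N) hD.kept_le hD.next_le (by omega)
    (fun s h => h.1.kept) (fun s h => h.1.next) (fun s h => h.1.len)
    ?_ ?_ ?_ (by omega) ⟨hs, rfl⟩).mono ?_
  · intro s1 k v hk hk' h
    exact ⟨h.1.setReg v hk, by simpa [hk'.symm] using h.2⟩
  · intro s1 h hx
    refine wp_load h.1 rfl (by omega) (by omega) (by omega) (by omega) (by omega) ?_
    intro s2 h2 hr hq _
    refine ⟨by omega, ⟨h2, (hq 14 (by omega) (by omega) (by omega)).trans h.2⟩, ?_⟩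
    refine ⟨?_, ?_, ?_, ?_, ?_, ?_⟩
    iterate 5 exact hq _ (by omega) (by omega) (by omega)
    rw [Test.Holds, hr, hq 14 (by omega) (by omega) (by omega), h.2]
    rfl
  · exact fun x y hx hy hxy hle => (hD.key_lt x y hx hy hxy).le.trans hle
  · exact fun t s' h => ⟨h.1, h.2.1.1, h.2.2⟩

theorem wp_searchGroup (hs : Rep U D s) (hD : D.Inv M A R ℓ d) (hl : D.len < U)
    (hU : 3 * U + 3 < 2 ^ w) (hN : U < 2 ^ N) :
    WP w ω searchGroupCode s fun t s' => t ≤ 20 * N + 5 ∧ Rep U D s' ∧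
      s'.reg 14 = s.reg 14 ∧ IsCut D.Group (fun x => D.start x ≤ s.reg 14) (s'.reg 16) := by
  have := hD.glen_le
  refine (wp_search (P := fun x => D.start x ≤ s.reg 14)
    (I := fun s' => Rep U D s' ∧ s'.reg 14 = s.reg 14) (N := N) hD.gkept_le hD.gnext_le (by omega)
    (fun s h => h.1.gkept) (fun s h => h.1.gnext) (fun s h => h.1.glen)
    ?_ ?_ ?_ (by omega) ⟨hs, rfl⟩).mono ?_
  · intro s1 k v hk hk' h
    exact ⟨h.1.setReg v hk, by simpa [hk'.symm] using h.2⟩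
  · intro s1 h hx
    refine wp_load h.1 rfl (by omega) (by omega) (by omega) (by omega) (by omega) ?_
    intro s2 h2 hr hq _
    refine ⟨by omega, ⟨h2, (hq 14 (by omega) (by omega) (by omega)).trans h.2⟩, ?_⟩
    refine ⟨?_, ?_, ?_, ?_, ?_, ?_⟩
    iterate 5 exact hq _ (by omega) (by omega) (by omega)
    rw [Test.Holds, hr, hq 14 (by omega) (by omega) (by omega), h.2]
    rfl
  · exact fun x y hx hy hxy hle => (hD.start_lt x y hx hy hxy).le.trans hle
  · exact fun t s' h => ⟨h.1, h.2.1.1, h.2.1.2, h.2.2⟩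

/-- Only order properties of the groups are assumed: the search runs after `last` has been
overwritten, when `val_le_last` may fail. -/
theorem wp_searchVal (hs : Rep U D s) (h1 : D.gkept ≤ D.gnext) (h2 : D.gnext ≤ D.glen)
    (hmono : ∀ x y, D.Group x → D.Group y → x < y → D.val x ≤ D.val y) (hl : D.glen < U)
    (hU : 3 * U + 3 < 2 ^ w) (hN : U < 2 ^ N) :
    WP w ω searchValCode s fun t s' => t ≤ 20 * N + 5 ∧ Rep U D s' ∧
      IsCut D.Group (fun x => D.val x < D.last) (s'.reg 16) := by
  refine wp_search (I := fun s' => Rep U D s') (N := N) h1 h2 (by omega)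
    (fun s h => h.gkept) (fun s h => h.gnext) (fun s h => h.glen)
    ?_ ?_ ?_ (by omega) hs
  · exact fun s1 k v hk _ h => h.setReg v hk
  · intro s1 h hx
    refine wp_vload h rfl (by omega) (by omega) ?_
    intro s2 h2 hr hq hv
    refine ⟨by omega, h2, ?_⟩
    rw [hq]
    refine ⟨rfl, rfl, rfl, rfl, rfl, ?_⟩
    rw [Test.Holds, hr, h2.last]
  · exact fun x y hx hy hxy hle => (hmono x y hx hy hxy).trans_lt hle

theorem wp_value {v : α} (hs : Rep U D s) (hD : D.Inv M A R ℓ d) (hl : D.len < U)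
    (hU : 3 * U + 3 < 2 ^ w) (hN : U < 2 ^ N) (hv : s.vreg 0 = v) (hpos : D.pos + 1 < 2 ^ w) :
    WP w ω valueCode s fun t s' => t ≤ 20 * N + 20 ∧
      ∃ e, IsCut D.Group (fun x => D.val x < v) e ∧ Rep U (D.value v e) s' := by
  have hgl := hD.glen_le
  have hgk := hD.gkept_le
  have hgn := hD.gnext_le
  refine wp_seq (wp_vcopy hv (wp_seq (wp_succ (v := D.pos) (by simpa using hs.pos) hpos
    (by omega) ?_)))
  have hs1 := ((hs.setLast v).setReg (k := 12) 1 (by omega)).setPos (D.pos + 1)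
  refine wp_seq ((wp_searchVal hs1 hgk hgn hD.val_le (by simp; omega) hU hN).mono ?_)
  rintro t s2 ⟨ht, hs2, hcut⟩
  obtain ⟨e, he⟩ : ∃ e, s2.reg 16 = e := ⟨_, rfl⟩
  rw [he] at hcut
  have hel : e ≤ D.glen := by
    have := hcut.pred_mem
    simp only [Data.Group, Live] at this
    omega
  refine wp_ite (fun hb => ?_) fun hb => ?_
  · have hb : e < D.gkept := by rw [Test.Holds, he, hs2.gkept] at hb; exact hb
    refine wp_seq (wp_vstore hs2 he hs2.last (by omega) fun s3 hs3 hr3 _ => wp_seq (wp_succ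
      (v := e) (by rw [hr3, he]) (by omega) (by omega) (wp_copy (v := D.glen)
      (by simp; exact hs3.glen) ⟨by omega, e, hcut, ?_⟩)))
    rw [Data.value, if_pos hb]
    exact ((hs3.setReg (k := 12) 1 (by omega)).setGkept (e + 1)).setGnext D.glen
  · have hb : ¬ e < D.gkept := by rw [Test.Holds, he, hs2.gkept] at hb; exact hb
    -- The common end of both branches, once register 16 has been moved out of the gap.
    have key : ∀ s3 : State α, ∀ t' ≤ 2, Rep U { D with last := v, pos := D.pos + 1 } s3 →
        s3.reg 16 = max e D.gnext → WP w ω (.ite (.lt 16 4) (.seq (.instr (.vstore 16 1))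
          (succCode 4 16)) (.instr .skip)) s3 fun t'' s' =>
          1 + (2 + (t + (t' + t'' + 1))) ≤ 20 * N + 20 ∧
          ∃ e, IsCut D.Group (fun x => D.val x < v) e ∧ Rep U (D.value v e) s' := by
      intro s3 t' ht' hs3 hr3
      refine wp_ite (fun hc => ?_) fun hc => ?_
      · have hc : max e D.gnext < D.glen := by rw [Test.Holds, hr3, hs3.glen] at hc; exact hc
        refine wp_seq (wp_vstore hs3 hr3 hs3.last (by omega) fun s4 hs4 hr4 _ =>
          wp_succ (v := max e D.gnext) (by rw [hr4, hr3]) (by omega) (by omega)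
          ⟨by omega, e, hcut, ?_⟩)
        rw [Data.value, if_neg hb, if_pos hc]
        exact (hs4.setReg (k := 12) 1 (by omega)).setGlen (max e D.gnext + 1)
      · have hc : ¬ max e D.gnext < D.glen := by rw [Test.Holds, hr3, hs3.glen] at hc; exact hc
        refine wp_skip ⟨by omega, e, hcut, ?_⟩
        rw [Data.value, if_neg hb, if_neg hc]
        exact hs3
    refine wp_seq (wp_ite (fun hc => ?_) fun hc => ?_)
    · have hc : e < D.gnext := by rw [Test.Holds, he, hs2.gnext] at hc; exact hc
      refine wp_copy hs2.gnext ?_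
      exact key _ _ (by omega) (hs2.setReg _ (by omega)) (by simp; omega)
    · have hc : ¬ e < D.gnext := by rw [Test.Holds, he, hs2.gnext] at hc; exact hc
      exact wp_skip (key _ _ (by omega) hs2 (by rw [he]; omega))

theorem wp_append (hs : Rep U D s) (hl : D.len < U) (hgl : D.glen < U) (hU : 3 * U + 3 < 2 ^ w) :
    WP w ω appendCode s fun t s' => t ≤ 21 ∧ Rep U D.append s' := by
  refine wp_seq (wp_store hs hs.len hs.pos (by omega) (by omega) (by omega) (by omega) hl
    (by omega) fun s1 hs1 _ _ => wp_seq (wp_const (by omega) ?_))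
  have hs2 := hs1.setReg (k := 13) 1 (by omega)
  refine wp_seq (wp_store hs2 hs2.len (v := 1) (by simp) (by omega) (by omega) (by omega)
    (by omega) hl (by omega) fun s3 hs3 _ _ => wp_seq (wp_succ hs3.len
    (show D.len + 1 < _ by omega) (by omega) ?_))
  have hs4 := (hs3.setReg (k := 12) 1 (by omega)).setLen (D.len + 1)
  refine wp_seq (wp_store hs4 hs4.glen hs4.pos (by omega) (by omega) (by omega)
    (by omega) hgl (by omega) fun s5 hs5 _ _ => wp_seq (wp_vstore hs5 hs5.glen hs5.last hgl
    fun s6 hs6 _ _ => wp_succ hs6.glen (show D.glen + 1 < _ by omega) (by omega) ⟨by omega, ?_⟩))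
  exact (hs6.setReg (k := 12) 1 (by omega)).setGlen (D.glen + 1)

theorem wp_moveGroup {e : ℕ} (hs : Rep U D s) (he : s.reg 16 = e) (hel : e ≤ D.glen)
    (hgk : D.gkept ≤ D.gnext) (hgl : D.glen < U) (hU : 3 * U + 3 < 2 ^ w) :
    WP w ω moveGroupCode s fun t s' => t ≤ 20 ∧ Rep U (D.moveGroup e) s' ∧
      s'.reg 14 = s.reg 14 := by
  refine wp_ite (fun hb => ?_) fun hb => ?_
  · have hb : D.gnext < e := by rw [Test.Holds, he, hs.gnext] at hb; exact hb
    refine wp_seq (wp_pred he (by omega) (by omega) (by omega) ?_)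
    have hs1 := (hs.setReg (k := 12) 1 (by omega)).setReg (k := 11) (e - 1) (by omega)
    refine wp_seq (wp_load hs1 (a := e - 1) (by simp) (by omega) (by omega) (by omega) (by omega)
      (by omega) fun s2 hs2 hr2 hq2 _ => ?_)
    refine wp_seq (wp_store hs2 hs2.gkept hr2 (by omega) (by omega) (by omega) (by omega)
      (by omega) (by omega) fun s3 hs3 hq3 _ => ?_)
    have h11 : s3.reg 11 = e - 1 := by
      rw [hq3 11 (by omega) (by omega), hq2 11 (by omega) (by omega) (by omega)]
      simp
    refine wp_seq (wp_vload hs3 h11 (by omega) (by omega) fun s4 hs4 hv4 hq4 _ => ?_)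
    refine wp_seq (wp_vstore hs4 hs4.gkept hv4 (show D.gkept < U by omega)
      fun s5 hs5 hq5 _ => ?_)
    refine wp_seq (wp_succ hs5.gkept (show D.gkept + 1 < _ by omega) (by omega) ?_)
    have h5 : ∀ q, q ≠ 11 → q ≠ 12 → q ≠ 13 → q ≠ 15 → s5.reg q = s.reg q := by
      intro q h1 h2 h3 h4
      rw [hq5, hq4, hq3 q h2 h4, hq2 q h2 h4 h3]
      simp [h1, h2]
    have h16 : s5.reg 16 = e := by
      rw [h5 16 (by omega) (by omega) (by omega) (by omega), he]
    refine wp_copy (v := e) (by simpa using h16) ⟨by omega, ?_, ?_⟩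
    · rw [Data.moveGroup, if_pos hb]
      exact ((hs5.setReg (k := 12) 1 (by omega)).setGkept (D.gkept + 1)).setGnext e
    · simpa using h5 14 (by omega) (by omega) (by omega) (by omega)
  · have hb : ¬ D.gnext < e := by rw [Test.Holds, he, hs.gnext] at hb; exact hb
    refine wp_skip ⟨by omega, ?_, rfl⟩
    rwa [Data.moveGroup, if_neg hb]

theorem wp_moveEntry (hs : Rep U D s) (h14 : s.reg 14 = D.key D.next) (hk : D.kept < U)
    (hn : D.next < U) (hU : 3 * U + 3 < 2 ^ w) :
    WP w ω moveEntryCode s fun t s' => t ≤ 15 ∧ Rep U D.moveEntry s' := by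
  refine wp_seq (wp_store hs hs.kept h14 (by omega) (by omega) (by omega) (by omega)
    (by omega) (by omega) fun s1 hs1 _ _ => wp_seq (wp_const (by omega) ?_))
  have hs2 := hs1.setReg (k := 13) 1 (by omega)
  refine wp_seq (wp_store hs2 hs2.kept (v := 1) (by simp) (by omega) (by omega) (by omega)
    (by omega) hk (by omega) fun s3 hs3 _ _ => wp_seq (wp_succ hs3.kept
    (show D.kept + 1 < _ by omega) (by omega) ?_))
  have hs4 := (hs3.setReg (k := 12) 1 (by omega)).setKept (D.kept + 1)
  refine wp_succ hs4.next (show D.next + 1 < _ by omega) (by omega) ⟨by omega, ?_⟩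
  exact (hs4.setReg (k := 12) 1 (by omega)).setNext (D.next + 1)

/-- One step of the pass pays one of the owed units; its cost is dominated by the search for the
group of the moved entry. -/
theorem wp_advance (hs : Rep U D s) (hD : D.Inv M A R ℓ (d + 1)) (hl : D.len < U)
    (hU : 3 * U + 3 < 2 ^ w) (hN : U < 2 ^ N) (hlt : D.next < D.len) :
    WP w ω advanceCode s fun t s' => t ≤ 20 * N + 60 ∧ ∃ D' : Data α, Rep U D' s' ∧
      D'.Inv M A R ℓ d ∧ D'.pos = D.pos ∧ D'.last = D.last := by
  have hkn := hD.kept_le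
  have hgl := hD.glen_le
  refine wp_seq (wp_load hs hs.next (by omega) (by omega) (by omega) (by omega) (by omega)
    fun s1 hs1 hr1 _ _ => wp_seq (wp_const (by omega) ?_))
  have hs2 := hs1.setReg (k := 12) 0 (by omega)
  refine wp_ite (fun hb => ?_) fun hb => ?_
  · have hb : D.alive D.next ≠ 0 := by
      simpa [Test.Holds, hr1, Data.word] using hb
    refine wp_seq (wp_load hs2 hs2.next (by omega) (by omega) (by omega) (by omega) (by omega)
      fun s3 hs3 hr3 _ _ => ?_)
    refine wp_seq ((wp_searchGroup hs3 hD hl hU hN).mono ?_)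
    rintro t4 s4 ⟨ht4, hs4, h14, hcut⟩
    have hel : s4.reg 16 ≤ D.glen := by
      have := hcut.pred_mem
      have := hD.gkept_le
      have := hD.gnext_le
      simp only [Data.Group, Live] at *
      omega
    refine wp_seq ((wp_moveGroup hs4 rfl hel hD.gkept_le (by omega) hU).mono ?_)
    rintro t5 s5 ⟨ht5, hs5, h14'⟩
    rw [hr3] at h14 hcut
    rw [h14] at h14'
    have e1 : (D.moveGroup (s4.reg 16)).kept = D.kept := by
      unfold Data.moveGroup; split_ifs <;> rfl
    have e2 : (D.moveGroup (s4.reg 16)).next = D.next := by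
      unfold Data.moveGroup; split_ifs <;> rfl
    have e3 : (D.moveGroup (s4.reg 16)).key = D.key := by
      unfold Data.moveGroup; split_ifs <;> rfl
    refine (wp_moveEntry hs5 (by rw [h14', e2, e3]; rfl) (by rw [e1]; omega) (by rw [e2]; omega)
      hU).mono ?_
    rintro t6 s6 ⟨ht6, hs6⟩
    refine ⟨by omega, _, hs6, hD.moveEntry hlt hb hcut, ?_, ?_⟩
    · unfold Data.moveGroup; split_ifs <;> rfl
    · unfold Data.moveGroup; split_ifs <;> rfl
  · have hb : D.alive D.next = 0 := by
      simpa [Test.Holds, hr1, Data.word] using hb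
    refine wp_succ hs2.next (by omega) (by omega) ⟨by omega, _, ?_, hD.dropEntry hlt hb, rfl, rfl⟩
    exact (hs2.setReg (k := 12) 1 (by omega)).setNext (D.next + 1)

theorem wp_finish (hs : Rep U D s) :
    WP w ω finishCode s fun t s' => t ≤ 7 ∧ Rep U D.finish s' := by
  have hpos : 0 < 2 ^ w := by positivity
  refine wp_ite (fun hb => ?_) fun hb => ?_
  · have hb : D.len ≤ D.next := by rw [Test.Holds, hs.len, hs.next] at hb; exact hb
    have h1 := hs.setLen D.kept
    have h2 := h1.setGlen D.gkept
    refine wp_seq (wp_copy hs.kept (wp_seq (wp_copy h1.gkept (wp_seq (wp_const hpos (wp_seq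
      (wp_const hpos (wp_seq (wp_const hpos (wp_const hpos ⟨by omega, ?_⟩))))))))))
    rw [Data.finish, if_pos hb]
    exact (((h2.setKept 0).setNext 0).setGkept 0).setGnext 0
  · have hb : ¬ D.len ≤ D.next := by rw [Test.Holds, hs.len, hs.next] at hb; exact hb
    refine wp_skip ⟨by omega, ?_⟩
    rwa [Data.finish, if_neg hb]

/-- A finished pass restarts at once. The restart clears the whole debt, which is why the result is
weakened to `d` by `mono`. -/
theorem wp_sweep (hs : Rep U D s) (hD : D.Inv M A R ℓ (d + 1)) (hd : d + 1 ≤ 3) (hA : A.card ≤ ℓ)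
    (hℓ : 3 * ℓ + 7 ≤ U) (hU : 3 * U + 3 < 2 ^ w) (hN : U < 2 ^ N) :
    WP w ω sweepCode s fun t s' => t ≤ 20 * N + 70 ∧ ∃ D' : Data α, Rep U D' s' ∧
      D'.Inv M A R ℓ d ∧ D'.pos = D.pos ∧ D'.last = D.last := by
  have hl := hD.len_le hd
  have hfin : ∀ D' : Data α, D'.finish.pos = D'.pos ∧ D'.finish.last = D'.last := by
    intro D'
    unfold Data.finish
    split_ifs <;> exact ⟨rfl, rfl⟩
  refine wp_seq (wp_ite (fun hb => ?_) fun hb => ?_)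
  · have hb : D.next < D.len := by rw [Test.Holds, hs.len, hs.next] at hb; exact hb
    refine (wp_advance hs hD (by omega) hU hN hb).mono ?_
    rintro t1 s1 ⟨ht1, D1, hs1, hD1, hp1, hl1⟩
    refine (wp_finish hs1).mono ?_
    rintro t2 s2 ⟨ht2, hs2⟩
    refine ⟨by omega, _, hs2, ?_, (hfin _).1.trans hp1, (hfin _).2.trans hl1⟩
    unfold Data.finish
    split_ifs with c
    · exact (hD1.restart (by omega) hA c).mono (by omega)
    · exact hD1
  · have hb : ¬ D.next < D.len := by rw [Test.Holds, hs.len, hs.next] at hb; exact hb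
    refine wp_skip ((wp_finish hs).mono ?_)
    rintro t2 s2 ⟨ht2, hs2⟩
    refine ⟨by omega, _, hs2, ?_, (hfin _).1, (hfin _).2⟩
    rw [Data.finish, if_pos (by omega)]
    exact (hD.restart hd hA (by omega)).mono (by omega)

/-- The append creates a debt of 3 and the three sweeps pay it off. With only two steps per mark the
same estimate would not close: a pass starting from `C` entries could end with about `ℓ + C` kept
ones. -/
theorem wp_mark {a : α} (hs : Rep U D s) (hD : D.Inv M A R ℓ 0) (hM : ∀ i ∈ M, i < D.pos)
    (hAM : A ⊆ M) (ha : D.last = a) (haR : R D.pos a)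
    (hA : (insert D.pos A).card ≤ ℓ)
    (hℓ : 3 * ℓ + 7 ≤ U) (hU : 3 * U + 3 < 2 ^ w) (hN : U < 2 ^ N) :
    WP w ω program.onMark s fun t s' => t ≤ 60 * N + 240 ∧ ∃ D' : Data α, Rep U D' s' ∧
      D'.Inv (insert D.pos M) (insert D.pos A) R ℓ 0 ∧ D'.pos = D.pos ∧ D'.last = D.last := by
  have hl := hD.len_le (by omega)
  have hgl := hD.glen_le
  refine wp_seq ((wp_append hs (by omega) (by omega) hU).mono ?_)
  rintro t1 s1 ⟨ht1, hs1⟩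
  have hD1 := hD.append hM hAM ha haR
  refine wp_seq ((wp_sweep hs1 hD1 (by omega) hA hℓ hU hN).mono ?_)
  rintro t2 s2 ⟨ht2, D2, hs2, hD2, hp2, hl2⟩
  refine wp_seq ((wp_sweep hs2 hD2 (by omega) hA hℓ hU hN).mono ?_)
  rintro t3 s3 ⟨ht3, D3, hs3, hD3, hp3, hl3⟩
  refine (wp_sweep hs3 hD3 (by omega) hA hℓ hU hN).mono ?_
  rintro t4 s4 ⟨ht4, D4, hs4, hD4, hp4, hl4⟩
  exact ⟨by omega, D4, hs4, hD4, by rw [hp4, hp3, hp2]; rfl, by rw [hl4, hl3, hl2]; rfl⟩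

/-- The last slot that satisfies a condition comes just before the cut. -/
theorem IsCut.sub_one_eq {L P : ℕ → Prop} {e g : ℕ} (he : IsCut L P e) (hg : L g) (hP : P g)
    (hn : ∀ h, L h → g < h → ¬ P h) : 1 ≤ e ∧ e - 1 = g := by
  have h1 := (he.lt_iff g hg).2 hP
  have h2 := he.pred_mem.resolve_left (by omega)
  refine ⟨by omega, ?_⟩
  by_contra hne
  exact hn _ h2 (by omega) ((he.lt_iff _ h2).1 (by omega))

theorem wp_query {i : ℕ} (hs : Rep U D s) (hD : D.Inv M A R ℓ 0) (hi : i ∈ A)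
    (h0 : s.reg 0 = i) (hℓ : 3 * ℓ + 7 ≤ U) (hU : 3 * U + 3 < 2 ^ w) (hN : U < 2 ^ N) :
    WP w ω queryCode s fun t s' => t ≤ 20 * N + 20 ∧ Rep U D s' ∧
      ∃ x : α, s'.vreg 0 = x ∧ R i x := by
  have hl := hD.len_le (by omega)
  have := hD.glen_le
  have := hD.gkept_le
  have := hD.gnext_le
  refine wp_seq (wp_copy h0 (wp_seq ((wp_searchGroup (hs.setReg i (by omega)) hD (by omega) hU
    hN).mono ?_)))
  rintro t1 s1 ⟨ht1, hs1, -, hcut⟩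
  obtain ⟨g, hg, hgi, hgn, x, hx, hxR⟩ := hD.exists_group i hi
  have hgU : g < U := by unfold Data.Group Live at hg; omega
  obtain ⟨he, he'⟩ := hcut.sub_one_eq hg (by simpa using hgi)
    (fun h hh hlt => by simpa using hgn h hh hlt)
  refine wp_seq (wp_pred rfl (by omega) he (by omega) (wp_vload ((hs1.setReg (k := 12) 1
    (by omega)).setReg (k := 11) _ (by omega)) (a := g) (by simpa using he') (by omega) (by omega)
    fun s2 hs2 hv2 _ _ => ⟨by omega, hs2, x, hv2.trans hx, hxR⟩))

/-- Keys increase strictly, so the last entry with key at most `i` is the entry of `i`. -/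
theorem wp_close {i : ℕ} (hs : Rep U D s) (hD : D.Inv M A R ℓ 0) (hi : i ∈ A)
    (h0 : s.reg 0 = i) (hℓ : 3 * ℓ + 7 ≤ U) (hU : 3 * U + 3 < 2 ^ w) (hN : U < 2 ^ N) :
    WP w ω closeCode s fun t s' => t ≤ 20 * N + 20 ∧ ∃ D' : Data α, Rep U D' s' ∧
      D'.Inv M (A \ {i}) R ℓ 0 ∧ D'.pos = D.pos ∧ D'.last = D.last := by
  have hl := hD.len_le (by omega)
  have := hD.kept_le
  have := hD.next_le
  refine wp_seq (wp_copy h0 (wp_seq ((wp_searchEntry (hs.setReg i (by omega)) hD (by omega) hU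
    hN).mono ?_)))
  rintro t1 s1 ⟨ht1, hs1, hcut⟩
  obtain ⟨g, hg, hgi, -⟩ := hD.exists_entry i hi
  have hgU : g < U := by unfold Data.Entry Live at hg; omega
  obtain ⟨he, he'⟩ := hcut.sub_one_eq hg (by simpa using hgi.le)
    (fun h hh hlt => by simpa [← hgi] using hD.key_lt g h hg hh hlt)
  have hs2 := (((hs1.setReg (k := 12) 1 (by omega)).setReg (k := 11) (s1.reg 16 - 1)
    (by omega)).setReg (k := 13) 0 (by omega))
  refine wp_seq (wp_pred rfl (by omega) he (by omega) (wp_seq (wp_const (by omega) (wp_store hs2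
    (a := g) (v := 0) (by simpa using he') (by simp) (by omega) (by omega) (by omega) (by omega)
    (by omega) (by omega) fun s3 hs3 _ _ => ⟨by omega, _, hs3, hD.close hg hgi, rfl, rfl⟩))))

end Commands

/-! ### Sequences of commands -/

section Sequences

variable {α : Type*} {cs : List (Cmd α)} {c : Cmd α}

theorem status_append : status (cs ++ [c]) = (status cs).next c := by
  simp [status, List.foldl_append]

theorem array_append_value {v : α} : array (cs ++ [.value v]) = array cs ++ [v] := by
  simp [array, List.filterMap_append]

theorem array_append_mark : array (cs ++ [.mark]) = array cs := by
  simp [array, List.filterMap_append]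

theorem array_append_query {i : ℕ} : array (cs ++ [.query i]) = array cs := by
  simp [array, List.filterMap_append]

theorem array_append_close {i : ℕ} : array (cs ++ [.close i]) = array cs := by
  simp [array, List.filterMap_append]

theorem length_array_le : (array cs).length ≤ (array (cs ++ [c])).length := by
  simp [array, List.filterMap_append]

theorem status_pos : (status cs).pos = (array cs).length := by
  induction cs using List.reverseRecOn with
  | nil => rfl
  | append_singleton cs c ih =>
    rw [status_append]
    cases c with
    | value v => simp [Status.next, ih, array_append_value]
    | mark => simp [Status.next, ih, array_append_mark]
    | query i => simp [Status.next, ih, array_append_query]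
    | close i => simp [Status.next, ih, array_append_close]

theorem Valid.of_append (h : Valid (cs ++ [c])) : Valid cs := by
  intro k d hk
  have hlt : k < cs.length := (List.getElem?_eq_some_iff.1 hk).1
  have := h k d (by rw [List.getElem?_append_left hlt]; exact hk)
  rwa [List.take_append_of_le_length hlt.le] at this

theorem Valid.admissible (h : Valid (cs ++ [c])) : Admissible cs c := by
  have := h cs.length c (by simp)
  simpa using this

theorem active_subset : active cs ⊆ (status cs).marked := Finset.sdiff_subset

theorem Valid.closed_subset (h : Valid cs) : (status cs).closed ⊆ (status cs).marked := by
  induction cs using List.reverseRecOn with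
  | nil => simp [status]
  | append_singleton cs c ih =>
    have ih := ih h.of_append
    have ha := h.admissible
    rw [status_append]
    cases c with
    | value v => exact ih
    | mark => exact ih.trans (Finset.subset_insert _ _)
    | query i => exact ih
    | close i => exact Finset.insert_subset (active_subset ha) ih

theorem Valid.marked_subset (h : Valid cs) :
    (status cs).marked ⊆ Finset.Icc 1 (status cs).pos := by
  induction cs using List.reverseRecOn with
  | nil => simp [status]
  | append_singleton cs c ih =>
    have ih := ih h.of_append
    have ha := h.admissible
    rw [status_append]
    cases c with
    | value v => exact ih.trans (Finset.Icc_subset_Icc_right (Nat.le_succ _))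
    | mark => exact Finset.insert_subset (Finset.mem_Icc.2 ⟨ha.1, le_rfl⟩) ih
    | query i => exact ih
    | close i => exact ih

theorem active_append_value {v : α} : active (cs ++ [.value v]) = active cs := by
  rw [active, status_append]
  rfl

theorem active_append_query {i : ℕ} : active (cs ++ [.query i]) = active cs := by
  rw [active, status_append]
  rfl

theorem active_append_close {i : ℕ} : active (cs ++ [.close i]) = active cs \ {i} := by
  rw [active, active, status_append]
  ext k
  simp only [Status.next, Finset.mem_sdiff, Finset.mem_insert, Finset.mem_singleton]
  tauto

/-- Closed positions were marked before, so a position marked for the first time cannot be closed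
already. -/
theorem Valid.active_append_mark (h : Valid (cs ++ [.mark])) :
    active (cs ++ [.mark]) = insert (status cs).pos (active cs) := by
  rw [active, active, status_append]
  have h1 : (status cs).pos ∉ (status cs).closed :=
    fun hc => h.admissible.2 (h.of_append.closed_subset hc)
  exact Finset.insert_sdiff_of_notMem _ h1

theorem maxActive_append : maxActive (cs ++ [c]) = max (maxActive cs) (active (cs ++ [c])).card := by
  have h : ∀ k ∈ Finset.range (cs.length + 1),
      (active ((cs ++ [c]).take k)).card = (active (cs.take k)).card := by
    intro k hk
    rw [List.take_append_of_le_length (Nat.lt_succ_iff.1 (Finset.mem_range.1 hk))]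
  rw [maxActive, maxActive, ← Finset.sup_congr rfl h, List.length_append, List.length_singleton,
    Finset.range_add_one, Finset.sup_insert, max_comm]
  congr 2
  rw [List.take_of_length_le (by simp)]

/-- Marked positions lie between 1 and the current one. This turns the assumption on the word size,
which speaks of `n`, into room for addresses linear in `ℓ`. -/
theorem Valid.maxActive_le (h : Valid cs) : maxActive cs ≤ (array cs).length := by
  induction cs using List.reverseRecOn with
  | nil => simp [maxActive, active, status]
  | append_singleton cs c ih =>
    rw [maxActive_append]
    refine max_le ((ih h.of_append).trans length_array_le) ?_
    have := Finset.card_le_card ((active_subset).trans h.marked_subset)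
    rwa [Nat.card_Icc, status_pos, Nat.add_sub_cancel] at this

variable [LinearOrder α]

/-- This is the property of `R` that `Inv.value` requires. -/
theorem IsRangeMin.append_value {i : ℕ} {x : α} (h : IsRangeMin cs i x) (v : α)
    (hi : i ≤ (array cs).length) : IsRangeMin (cs ++ [.value v]) i (min x v) := by
  obtain ⟨⟨k, h1, h2, h3, h4⟩, hlb⟩ := h
  constructor
  · rcases le_total x v with hxv | hxv
    · rw [min_eq_left hxv]
      refine ⟨k, h1, h2, by rw [array_append_value]; simp; omega, ?_⟩
      rw [array_append_value, List.getElem?_append_left (by omega), h4]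
    · rw [min_eq_right hxv]
      refine ⟨(array cs).length + 1, by omega, by omega, by simp [array_append_value], ?_⟩
      simp [array_append_value]
  · rintro y ⟨l, g1, g2, g3, g4⟩
    rw [array_append_value] at g3 g4
    simp only [List.length_append, List.length_singleton] at g3
    rcases Nat.lt_or_ge (l - 1) (array cs).length with hl | hl
    · rw [List.getElem?_append_left hl] at g4
      exact (min_le_left _ _).trans (hlb ⟨l, g1, g2, by omega, g4⟩)
    · have : l = (array cs).length + 1 := by omega
      subst this
      simp at g4
      exact g4 ▸ min_le_right _ _

theorem isRangeMin_getLast {a : α} (h : (array cs).getLast? = some a) :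
    IsRangeMin cs (status cs).pos a := by
  rw [List.getLast?_eq_getElem?] at h
  have hlt := (List.getElem?_eq_some_iff.1 h).1
  rw [status_pos]
  refine ⟨⟨_, by omega, le_rfl, le_rfl, h⟩, ?_⟩
  rintro y ⟨l, g1, g2, g3, g4⟩
  have : l = (array cs).length := by omega
  subst this
  rw [h] at g4
  exact (Option.some.inj g4).le

theorem isRangeMin_congr {cs cs' : List (Cmd α)} (h : array cs = array cs') :
    IsRangeMin cs = IsRangeMin cs' := by
  funext i x
  simp only [IsRangeMin, h]

end Sequences

/-! ### Runs of the program -/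

section Runs

/-- The data at the start. -/
def Data.empty (α : Type*) : Data α where
  len := 0
  kept := 0
  next := 0
  glen := 0
  gkept := 0
  gnext := 0
  pos := 0
  key := fun _ => 0
  alive := fun _ => 0
  start := fun _ => 0
  val := fun _ => ⊥
  last := ⊥

theorem rep_empty {α : Type*} {U : ℕ} : Rep U (Data.empty α) (State.init α) := by
  refine ⟨rfl, rfl, rfl, rfl, rfl, rfl, rfl, ?_, rfl, rfl, Nat.zero_le _, Nat.zero_le _⟩
  intro x k hk
  interval_cases k <;> rfl

variable {α : Type*} [LinearOrder α] {w : ℕ} {ω : ℕ → Fin (2 ^ w)}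

theorem Run.append {P : Program} {s s' s'' : State α} {cs : List (Cmd α)} {c : Cmd α}
    {tr : List (ℕ × WithBot α)} {t : ℕ} (h : Run P w ω s cs tr s')
    (he : Exec w ω (P.code c) (s'.input w c) t s'') :
    Run P w ω s (cs ++ [c]) (tr ++ [(t, s''.vreg 0)]) s'' := by
  induction h with
  | nil s => exact .cons he (.nil _)
  | cons h1 _ ih => exact .cons h1 (ih he)

theorem inv_empty {R : ℕ → α → Prop} {ℓ : ℕ} : (Data.empty α).Inv ∅ ∅ R ℓ 0 := by
  constructor <;> simp [Data.empty, Data.Entry, Data.Group, Live, Data.pending]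

/-- The command of the step is carried out within the given time, and a query is answered
correctly. -/
def GoodStep (cs : List (Cmd α)) (T k t : ℕ) (x : WithBot α) : Prop :=
  t ≤ T ∧ ∀ i, cs[k]? = some (.query i) → ∃ a : α, x = a ∧ IsRangeMin (cs.take k) i a

/-- One command: from the data after the commands `cs` to the data after one more. -/
theorem wp_command {ℓ U N : ℕ} {cs : List (Cmd α)} {c : Cmd α} {D : Data α} {s : State α}
    (hv : Valid (cs ++ [c])) (hℓ : (active (cs ++ [c])).card ≤ ℓ) (hU : 3 * ℓ + 7 ≤ U)
    (hw : 3 * U + 3 < 2 ^ w) (hN : U < 2 ^ N) (hn : (array (cs ++ [c])).length < 2 ^ w)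
    (hs : Rep U D s) (hD : D.Inv (status cs).marked (active cs) (IsRangeMin cs) ℓ 0)
    (hpos : D.pos = (status cs).pos) (hlast : ∀ a, (array cs).getLast? = some a → D.last = a) :
    WP w ω (program.code c) (s.input w c) fun t s' => ∃ D' : Data α, Rep U D' s' ∧
      D'.Inv (status (cs ++ [c])).marked (active (cs ++ [c])) (IsRangeMin (cs ++ [c])) ℓ 0 ∧
      D'.pos = (status (cs ++ [c])).pos ∧
      (∀ a, (array (cs ++ [c])).getLast? = some a → D'.last = a) ∧
      t ≤ 60 * N + 240 ∧ ∀ i, c = .query i → ∃ a : α, s'.vreg 0 = a ∧ IsRangeMin cs i a := by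
  have hl := hD.len_le (by omega)
  have ha := hv.admissible
  have hms := hv.of_append.marked_subset
  have hact : ∀ i ∈ active cs, i ≤ (array cs).length := by
    intro i hi
    rw [← status_pos]
    exact (Finset.mem_Icc.1 (hms (active_subset hi))).2
  have hle := length_array_le (cs := cs) (c := c)
  rw [status_append]
  cases c with
  | value v =>
    rw [array_append_value] at hn ⊢
    simp only [List.length_append, List.length_singleton] at hn
    rw [status_pos] at hpos
    refine (wp_value (v := v) (hs.setVreg (k := 0) v (by omega)) hD (by omega) hw hN (by simp)
      (by omega)).mono ?_
    rintro t s' ⟨ht, e, hcut, hs'⟩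
    refine ⟨_, hs', ?_, ?_, ?_, by omega, by simp⟩
    · rw [active_append_value]
      exact hD.value v (fun i hi x hx => hx.append_value v (hact i hi)) hcut
    · have : (D.value v e).pos = D.pos + 1 := by
        unfold Data.value; split_ifs <;> rfl
      rw [this, hpos, ← status_pos]
      rfl
    · have : (D.value v e).last = v := by
        unfold Data.value; split_ifs <;> rfl
      intro a hva
      rw [this]
      simpa using hva
  | mark =>
    obtain ⟨a, hla⟩ : ∃ a, (array cs).getLast? = some a := by
      have := ha.1
      rw [status_pos] at this
      exact ⟨_, List.getLast?_eq_some_getLast (List.ne_nil_of_length_pos this)⟩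
    rw [hv.active_append_mark] at hℓ ⊢
    rw [array_append_mark, isRangeMin_congr array_append_mark]
    refine (wp_mark hs hD ?_ active_subset (hlast a hla) ?_ ?_ hU hw hN).mono ?_
    · intro i hi
      rw [hpos]
      refine lt_of_le_of_ne (Finset.mem_Icc.1 (hms hi)).2 ?_
      rintro rfl
      exact ha.2 hi
    · rw [hpos]
      exact isRangeMin_getLast hla
    · rwa [hpos]
    · rintro t s' ⟨ht, D', hs', hD', hp', hl'⟩
      rw [hpos] at hD'
      exact ⟨D', hs', hD', hp'.trans hpos, fun b hb => hl'.trans (hlast b hb), ht, by simp⟩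
  | query i =>
    -- An active position is at most `n`, so it is passed in a word without truncation.
    have hiw : i % 2 ^ w = i := Nat.mod_eq_of_lt ((hact i ha).trans_lt (by omega))
    rw [active_append_query, array_append_query, isRangeMin_congr array_append_query]
    refine (wp_query (hs.setReg_zero (i % 2 ^ w)) hD ha (by simpa using hiw) hU hw hN).mono ?_
    rintro t s' ⟨ht, hs', hx⟩
    refine ⟨D, hs', hD, hpos, hlast, by omega, ?_⟩
    rintro j hj
    cases hj
    exact hx
  | close i =>
    have hiw : i % 2 ^ w = i := Nat.mod_eq_of_lt ((hact i ha).trans_lt (by omega))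
    rw [active_append_close, array_append_close, isRangeMin_congr array_append_close]
    refine (wp_close (hs.setReg_zero (i % 2 ^ w)) hD ha (by simpa using hiw) hU hw hN).mono ?_
    rintro t s' ⟨ht, D', hs', hD', hp', hl'⟩
    exact ⟨D', hs', hD', hp'.trans hpos, fun b hb => hl'.trans (hlast b hb), by omega, by simp⟩

/-- Induction by appending a command at the end, with `ℓ` and `U` fixed in advance as bounds for the
whole sequence. -/
theorem run_program {ℓ U N : ℕ} {cs : List (Cmd α)} (hv : Valid cs) (hℓ : maxActive cs ≤ ℓ)
    (hU : 3 * ℓ + 7 ≤ U) (hw : 3 * U + 3 < 2 ^ w) (hN : U < 2 ^ N)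
    (hn : (array cs).length < 2 ^ w) :
    ∃ (tr : List (ℕ × WithBot α)) (s : State α) (D : Data α),
      Run program w ω (State.init α) cs tr s ∧ Rep U D s ∧
      D.Inv (status cs).marked (active cs) (IsRangeMin cs) ℓ 0 ∧ D.pos = (status cs).pos ∧
      (∀ a, (array cs).getLast? = some a → D.last = a) ∧ tr.length = cs.length ∧
      ∀ k t x, tr[k]? = some (t, x) → GoodStep cs (60 * N + 240) k t x := by
  induction cs using List.reverseRecOn with
  | nil =>
    exact ⟨[], _, _, .nil _, rep_empty, inv_empty, rfl, by simp [array], rfl, by simp⟩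
  | append_singleton cs c ih =>
    rw [maxActive_append] at hℓ
    obtain ⟨tr, s, D, hrun, hs, hD, hpos, hlast, hlen, hgood⟩ := ih hv.of_append
      ((le_max_left _ _).trans hℓ) (length_array_le.trans_lt hn)
    obtain ⟨t, s', hex, D', hs', hD', hpos', hlast', ht, hans⟩ :=
      wp_command hv ((le_max_right _ _).trans hℓ) hU hw hN hn hs hD hpos hlast
    refine ⟨_, s', D', hrun.append hex, hs', hD', hpos', hlast', by simp [hlen], ?_⟩
    intro k t' x hk
    rcases Nat.lt_or_ge k cs.length with hkl | hkl
    · rw [List.getElem?_append_left (by omega)] at hk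
      refine ⟨(hgood k t' x hk).1, fun i hi => ?_⟩
      rw [List.getElem?_append_left hkl] at hi
      rw [List.take_append_of_le_length hkl.le]
      exact (hgood k t' x hk).2 i hi
    · have hkl' : k = cs.length := by
        have := (List.getElem?_eq_some_iff.1 hk).1
        simp only [List.length_append, List.length_singleton] at this
        omega
      subst hkl'
      rw [List.getElem?_append_right (by omega)] at hk
      simp only [hlen, Nat.sub_self, List.getElem?_cons_zero, Option.some.injEq,
        Prod.mk.injEq] at hk
      obtain ⟨rfl, rfl⟩ := hk
      refine ⟨ht, fun i hi => ?_⟩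
      simp only [List.getElem?_append_right le_rfl, Nat.sub_self, List.getElem?_cons_zero,
        Option.some.injEq] at hi
      simpa using hans i hi

end Runs

/-! ### Constants and conclusion -/

/-- With `L = Nat.log 2 (ℓ + 2) ≥ 1`, the left side is at most `60 * (L + 3) + 240 ≤ 480 * L`, and
`Real.log 2 ≥ 1 / 2` doubles the constant. -/
theorem steps_le_log (ℓ : ℕ) : ((60 * (Nat.log 2 (3 * ℓ + 7) + 1) + 240 : ℕ) : ℝ) ≤
    (960 : ℕ) * Real.log ((ℓ : ℝ) + 2) := by
  obtain ⟨L, hL⟩ : ∃ L, L = Nat.log 2 (ℓ + 2) := ⟨_, rfl⟩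
  have h1 : Nat.log 2 (3 * ℓ + 7) ≤ L + 2 := by
    have : 3 * ℓ + 7 < 2 ^ (L + 3) := by
      have := Nat.lt_pow_succ_log_self (b := 2) one_lt_two (ℓ + 2)
      rw [← hL, Nat.succ_eq_add_one, pow_succ] at this
      rw [pow_add]
      omega
    have := Nat.log_lt_of_lt_pow (by omega) this
    omega
  have h2 : 1 ≤ L := by
    rw [hL]
    exact Nat.log_pos one_lt_two (by omega)
  have h3 : (L : ℝ) * Real.log 2 ≤ Real.log ((ℓ : ℝ) + 2) := by
    rw [← Real.log_pow]
    refine Real.log_le_log (by positivity) ?_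
    have := Nat.pow_log_le_self 2 (x := ℓ + 2) (by omega)
    rw [← hL] at this
    exact_mod_cast this
  have h4 : (1 / 2 : ℝ) ≤ Real.log 2 := by
    have := Real.log_two_gt_d9
    linarith
  have h5 : (L : ℝ) * (1 / 2) ≤ L * Real.log 2 := by gcongr
  have h6 : 60 * (Nat.log 2 (3 * ℓ + 7) + 1) + 240 ≤ 480 * L := by omega
  have h7 : ((60 * (Nat.log 2 (3 * ℓ + 7) + 1) + 240 : ℕ) : ℝ) ≤ (480 * L : ℕ) := by
    exact_mod_cast h6
  refine h7.trans ?_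
  push_cast
  linarith

end RMQ

theorem mainTheorem4 :
    ∃ (P : RMQ.Program) (K : ℕ),
      -- every answer is right, in linear space, whatever the random words are
      (∀ (α : Type*) [LinearOrder α] (cs : List (RMQ.Cmd α)) (w : ℕ), RMQ.Valid cs →
        K * ((RMQ.array cs).length + 1) ≤ 2 ^ w →
        ∀ ω : ℕ → Fin (2 ^ w), ∃ (tr : List (ℕ × WithBot α)) (s : RMQ.State α),
          RMQ.Run P w ω (RMQ.State.init α) cs tr s ∧
          s.space ≤ K * (RMQ.maxActive cs + 1) ∧
          ∀ k i : ℕ, cs[k]? = some (RMQ.Cmd.query i) →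
            ∃ (t : ℕ) (x : α), tr[k]? = some (t, (x : WithBot α)) ∧
              RMQ.IsRangeMin (cs.take k) i x) ∧
      -- every single command takes logarithmic time with high probability
      (∀ c : ℕ, ∃ T : ℕ,
        ∀ (α : Type*) [LinearOrder α] (cs : List (RMQ.Cmd α)) (w : ℕ), RMQ.Valid cs →
        K * ((RMQ.array cs).length + 1) ≤ 2 ^ w →
        ∀ k < cs.length,
          RMQ.wordLaw w {ω | ¬ RMQ.StepsAtMost P w cs k
              (T * Real.log ((RMQ.maxActive cs : ℝ) + 2)) ω} ≤
            (((RMQ.maxActive cs : ENNReal) + 2) ^ c)⁻¹) := by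
  -- For `U = 3 * ℓ + 7` the space is at most `4 * U = 12 * ℓ + 28`, and addresses need `3 * U + 3 =
  -- 9 * ℓ + 24 < 2 ^ w`; 40 covers both since `ℓ ≤ n`. The time constant 960 serves every `c`.
  refine ⟨RMQ.program, 40, ?_, fun c => ⟨960, ?_⟩⟩
  · intro α _ cs w hv hw ω
    have hle := hv.maxActive_le
    obtain ⟨tr, s, D, hrun, hs, -, -, -, hlen, hgood⟩ := RMQ.run_program (ω := ω) hv le_rfl
      le_rfl (by omega) (Nat.lt_pow_succ_log_self one_lt_two _) (by omega)
    refine ⟨tr, s, hrun, ?_, ?_⟩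
    · have := hs.used
      have := hs.vused
      unfold RMQ.State.space
      omega
    · intro k i hk
      have hkl : k < tr.length := hlen ▸ (List.getElem?_eq_some_iff.1 hk).1
      obtain ⟨a, ha, hR⟩ := (hgood k _ _ (List.getElem?_eq_getElem hkl)).2 i hk
      exact ⟨_, a, by rw [← ha]; exact List.getElem?_eq_getElem hkl, hR⟩
  · intro α _ cs w hv hw k hk
    have hle := hv.maxActive_le
    -- The step bound holds for every `ω`, so the failure event is empty whatever the law.
    have hempty : {ω | ¬ RMQ.StepsAtMost RMQ.program w cs k
        ((960 : ℕ) * Real.log ((RMQ.maxActive cs : ℝ) + 2)) ω} = ∅ := by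
      refine Set.eq_empty_of_forall_notMem fun ω hω => hω ?_
      obtain ⟨tr, s, D, hrun, -, -, -, -, hlen, hgood⟩ := RMQ.run_program (ω := ω) hv le_rfl
        le_rfl (by omega) (Nat.lt_pow_succ_log_self one_lt_two _) (by omega)
      have hkl : k < tr.length := hlen ▸ hk
      have ht := (hgood k _ _ (List.getElem?_eq_getElem hkl)).1
      exact ⟨tr, s, _, _, hrun, List.getElem?_eq_getElem hkl,
        (Nat.cast_le.2 ht).trans (RMQ.steps_le_log _)⟩
    rw [hempty, MeasureTheory.measure_empty]
    exact zero_le
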